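/- Words and conventions. A permutation $a_1a_2\ldots a_n$ of $\{1,\ldots,n\}$ is 312-avoiding if there are no $i<j<l$ with $a_j<a_l<a_i$. Its up/down pattern is the word $x_1\ldots x_{n-1}$ with $x_i=D$ if $a_i>a_{i+1}$ and $x_i=U$ if $a_i<a_{i+1}$. It is decent, with $k$ blocks, if its up/down pattern has the form $D^{i_1}UD^{i_2}U\cdots UD^{i_k}$ with $k\ge 1$ and every $i_t\ge 1$. Polygons are convex, with vertices labelled $1,2,\ldots$ in cyclic order; a dissection of a polygon by $d$ diagonals is a set of $d$ pairwise noncrossing diagonals, and a triangulation of an $N$-gon is a dissection by $N-3$ diagonals. The clip sequence of a triangulation of an $(n+2)$-gon is obtained by $n$ times deleting (and recording) the vertex of degree $2$ with the smallest label, together with its two incident edges; each deletion cuts off one triangle. Theorem. Let $1\le k<n$. The decent 312-avoiding permutations of $\{1,\ldots,n\}$ with $k$ blocks (that is, with up/down pattern $D^{i_1}UD^{i_2}U\cdots UD^{i_k}$ for some $i_1,\ldots,i_k\ge 1$) are in bijection with the dissections of an $(n-k+2)$-gon by $k-1$ diagonals. More precisely, each such permutation $\pi$ is the clip sequence of exactly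 one triangulation $T$ of the $(n+2)$-gon, and a bijection is given by the following procedure. Write $\pi$ as the concatenation of its maximal decreasing runs. For every run, remove the triangle that was cut off at its first entry, and merge the triangles that were cut off at its other entries into one polygon by erasing the diagonals between them. Each side of the $(n+2)$-gon that belonged to a removed triangle and whose two ends are still vertices of the remaining triangles leaves a gap; close it by identifying these two ends. Finally relabel the vertices in order by $1,\ldots,n-k+2$; the remaining diagonals of $T$, except those that have become sides, form the dissection. -/

import Mathlib

/-! ### Permutations

A permutation of `{1, …, n}` is an element `π : Equiv.Perm (Fin n)`, read as the word
`π 0, π 1, …, π (n - 1)`; the label `v + 1` of the usual notation is `v : Fin n` here. -/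

/-- `π` is 312-avoiding: there are no positions `i < j < l` with `π j < π l < π i`. -/
def Avoids312 {n : ℕ} (π : Equiv.Perm (Fin n)) : Prop :=
  ∀ i j l : Fin n, i < j → j < l → ¬ (π j < π l ∧ π l < π i)

/-- The two letters of up/down patterns. -/
inductive UpDown : Type
  | U : UpDown
  | D : UpDown

/-- The up/down pattern of `a_1 ⋯ a_n`: the word `x_1 ⋯ x_{n-1}` with `x_i = D` if
`a_i > a_{i+1}` and `x_i = U` if `a_i < a_{i+1}`. -/
def upDownPattern {n : ℕ} (π : Equiv.Perm (Fin n)) : List UpDown :=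
  List.zipWith (fun a b => if b < a then UpDown.D else UpDown.U)
    (List.ofFn π) (List.ofFn π).tail

/-- The word `D^{i_1} U D^{i_2} U ⋯ U D^{i_k}` for the list `[i_1, …, i_k]`. -/
def descentBlocks (I : List ℕ) : List UpDown :=
  List.intercalate [UpDown.U] (I.map fun i => List.replicate i UpDown.D)

/-- The up/down pattern of `π` is `D^{i_1} U D^{i_2} U ⋯ U D^{i_k}` for some
`i_1, …, i_k ≥ 1`, with exactly `k` blocks. A permutation is decent if this holds for some
`k ≥ 1`. -/
def IsDecentWithBlocks {n : ℕ} (k : ℕ) (π : Equiv.Perm (Fin n)) : Prop :=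
  ∃ I : List ℕ, I.length = k ∧ (∀ i ∈ I, 1 ≤ i) ∧ upDownPattern π = descentBlocks I

/-- The decent 312-avoiding permutations with `k` blocks of descents. -/
def decentPerms312 (n k : ℕ) : Set (Equiv.Perm (Fin n)) :=
  {π | Avoids312 π ∧ IsDecentWithBlocks k π}

/-! ### Polygons, dissections, triangulations

The vertices of the (labelled, convex) `N`-gon are the elements of `Fin N` in cyclic order. -/

/-- The sides of the `N`-gon: vertex `i` is joined to its cyclic successor. -/
def polygonSides (N : ℕ) : Finset (Sym2 (Fin N)) :=
  Finset.univ.image fun i => s(i, finRotate N i)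

/-- A diagonal joins two distinct vertices that are not the ends of a side. -/
def IsDiagonal {N : ℕ} (e : Sym2 (Fin N)) : Prop :=
  ¬ e.IsDiag ∧ e ∉ polygonSides N

/-- Two chords of a convex polygon cross (in their interiors) iff their ends are four
distinct vertices that alternate around the polygon. -/
def Crosses {N : ℕ} (e f : Sym2 (Fin N)) : Prop :=
  ∃ a b c d : Fin N, a < b ∧ b < c ∧ c < d ∧
    ((e = s(a, c) ∧ f = s(b, d)) ∨ (e = s(b, d) ∧ f = s(a, c)))

/-- A dissection of the `N`-gon, given by its set of pairwise noncrossing diagonals. -/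
def IsDissection {N : ℕ} (E : Finset (Sym2 (Fin N))) : Prop :=
  (∀ e ∈ E, IsDiagonal e) ∧ ∀ e ∈ E, ∀ f ∈ E, ¬ Crosses e f

/-- The dissections of the `N`-gon by exactly `d` diagonals. -/
def dissections (N d : ℕ) : Set (Finset (Sym2 (Fin N))) :=
  {E | IsDissection E ∧ E.card = d}

/-- The triangulations of the `N`-gon: the dissections by `N - 3` diagonals. -/
def triangulations (N : ℕ) : Set (Finset (Sym2 (Fin N))) :=
  dissections N (N - 3)

/-! ### Clip sequences of triangulations of the `(n + 2)`-gon -/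

/-- The vertex of the `(n + 2)`-gon whose label is the `i`-th entry of `π`. -/
def clipVertex {n : ℕ} (π : Equiv.Perm (Fin n)) (i : Fin n) : Fin (n + 2) :=
  Fin.castAdd 2 (π i)

/-- The vertices that are left just before the `i`-th step, when the vertices
`π 0, …, π (i - 1)` have been deleted. -/
def remainingVertices {n : ℕ} (π : Equiv.Perm (Fin n)) (i : Fin n) : Finset (Fin (n + 2)) :=
  Finset.univ.filter fun v => ∀ j : Fin n, j < i → v ≠ clipVertex π j

/-- The neighbours of `v` in the graph formed by the sides of the polygon and the diagonals
in `T`, restricted to the vertex set `S`. -/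
def neighboursIn {N : ℕ} (T : Finset (Sym2 (Fin N))) (S : Finset (Fin N)) (v : Fin N) :
    Finset (Fin N) :=
  S.filter fun w => s(v, w) ∈ polygonSides N ∪ T

/-- `π` is the clip sequence of the triangulation `T`: at each step, the vertex that is
deleted (and recorded) is the one with the smallest label among the vertices of degree 2
in what is left of the graph. -/
def IsClipSequence {n : ℕ} (T : Finset (Sym2 (Fin (n + 2)))) (π : Equiv.Perm (Fin n)) : Prop :=
  ∀ i : Fin n, IsLeast
    {v | v ∈ remainingVertices π i ∧ (neighboursIn T (remainingVertices π i) v).card = 2}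
    (clipVertex π i)

/-- The triangle that is cut off at the `i`-th step: the deleted vertex and its two
remaining neighbours. -/
def clipTriangle {n : ℕ} (T : Finset (Sym2 (Fin (n + 2)))) (π : Equiv.Perm (Fin n))
    (i : Fin n) : Finset (Fin (n + 2)) :=
  insert (clipVertex π i) (neighboursIn T (remainingVertices π i) (clipVertex π i))

/-! ### From triangulations to dissections: merging runs and closing gaps

The word `π` is a concatenation of maximal decreasing runs `c_{r1} > c_{r2} > ⋯`. The
triangles of the first entries `c_{r1}` are removed, those of the other entries of a run are
merged. -/

/-- The position `i` is the first one of a maximal decreasing run of `π`. -/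
def IsRunStart {n : ℕ} (π : Equiv.Perm (Fin n)) (i : Fin n) : Prop :=
  ∀ j : Fin n, j.val + 1 = i.val → π j < π i

/-- The positions `i` and `j` lie in the same maximal decreasing run: no run starts strictly
after one of them and not after the other. -/
def SameRun {n : ℕ} (π : Equiv.Perm (Fin n)) (i j : Fin n) : Prop :=
  ∀ l : Fin n, min i j < l → l ≤ max i j → ¬ IsRunStart π l

/-- The diagonal `d` is erased by merging: it is a common side of two triangles that belong
to entries of the same run, both of them different from the first entry of the run. -/
def IsMerged {n : ℕ} (T : Finset (Sym2 (Fin (n + 2)))) (π : Equiv.Perm (Fin n))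
    (d : Sym2 (Fin (n + 2))) : Prop :=
  ∃ i j : Fin n, i ≠ j ∧ SameRun π i j ∧ ¬ IsRunStart π i ∧ ¬ IsRunStart π j ∧
    (∀ v ∈ d, v ∈ clipTriangle T π i) ∧ (∀ v ∈ d, v ∈ clipTriangle T π j)

/-- The vertex `v` survives the removal of the triangles of the first entries of the runs:
it is a vertex of some other triangle. -/
def Survives {n : ℕ} (T : Finset (Sym2 (Fin (n + 2)))) (π : Equiv.Perm (Fin n))
    (v : Fin (n + 2)) : Prop :=
  ∃ i : Fin n, ¬ IsRunStart π i ∧ v ∈ clipTriangle T π i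

/-- `u` and `v` are the two ends of a gap: surviving vertices that were joined by a side of
the polygon, and this side belonged to a triangle that was removed. -/
def IsGap {n : ℕ} (T : Finset (Sym2 (Fin (n + 2)))) (π : Equiv.Perm (Fin n))
    (u v : Fin (n + 2)) : Prop :=
  Survives T π u ∧ Survives T π v ∧ s(u, v) ∈ polygonSides (n + 2) ∧
    ∃ i : Fin n, IsRunStart π i ∧ u ∈ clipTriangle T π i ∧ v ∈ clipTriangle T π i

/-- `E` is the set of diagonals of the `N`-gon that results from `T` by removing the
triangles of the first entries of the runs of `π`, merging the other triangles of each run,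
closing the gaps (identifying the ends of each gap) and relabelling the vertices by
`1, …, N` in their order: `ρ` sends each surviving vertex to its new label. A diagonal of `T`
may become a side of the `N`-gon (when an ear next to it is removed), and then it is no
longer counted as a diagonal. -/
def ClosesUpTo {n N : ℕ} (T : Finset (Sym2 (Fin (n + 2)))) (π : Equiv.Perm (Fin n))
    (E : Finset (Sym2 (Fin N))) : Prop :=
  ∃ ρ : Fin (n + 2) → Fin N,
    (∀ u v, Survives T π u → Survives T π v → u ≤ v → ρ u ≤ ρ v) ∧
    (∀ u v, Survives T π u → Survives T π v →
      (ρ u = ρ v ↔ Relation.EqvGen (IsGap T π) u v)) ∧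
    (∀ x : Fin N, ∃ v, Survives T π v ∧ ρ v = x) ∧
    (∀ e : Sym2 (Fin N), e ∈ E ↔
      IsDiagonal e ∧ ∃ d ∈ T, ¬ IsMerged T π d ∧ Sym2.map ρ d = e)

/-! Number the vertices of the `(M + 2)`-gon by `0, …, M + 1` in cyclic order so that the root side
`{0, M + 1}` joins the two largest labels; for `M = n` these are the two vertices that clipping
never deletes. A dissection into `k` regions is encoded by a height function `q`: an inner vertex
`x` gets the postorder rank of the region directly under the smallest chord (or root side) passing
strictly over `x`, and the two outer vertices get `k`. The functions that arise are those of
`IsRegionOrder`, whose main condition is a weak form of 312-avoidance. The diagonals come back as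
the mutually visible pairs, those with only lower vertices between them. Thus region orders with `k`
values correspond to dissections by `k - 1` diagonals (`IsRegionOrder.card_chordsOf`,
`IsRegionOrder.eq_of_chordsOf_eq`, `exists_isRegionOrder`).

For a triangulation `M = k = n`, the ranks are distinct, and `q` is the inverse of a 312-avoiding
permutation: the rank of a vertex is the step at which it is clipped (`isClipSequence_chordsOf`,
`exists_perm_of_triangulation`).

In a 312-avoiding `π`, the entry `a` starts a decreasing run exactly when `a + 1` is deleted after
`a` (`kept_iff`). If all runs have length at least two, the second entry `v` of the run is smaller
than `a`, and the triangle cut off at `a` is `v, a, a + 1`. Removing it makes `a` disappear or be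
identified with `a + 1`. The remaining `n - k` inner vertices, with their run indices as heights,
form a region order (`HasLongRuns.isRegionOrder`), and its visible chords are the result of the
procedure (`HasLongRuns.closesUpTo`).

Conversely, `q` determines where the run starts go. In position, the start of run `r` precedes all
other entries of rank `r`; in size, it lies just below the right end of the chord above region `r`.
So `π` is recovered by sorting `k + M` letters by two keys (`HasLongRuns.represents`,
`Represents.unique`, `regionOrder_of_keys`). -/

namespace DecentClip

/-! ### Chords and crossings in linear coordinates. -/

/-- The vertices of the `(M + 2)`-gon in their cyclic order, starting from the one with the
largest label. -/
def vtx (M a : ℕ) : Fin (M + 2) :=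
  if h : 1 ≤ a ∧ a ≤ M + 1 then ⟨a - 1, by omega⟩ else Fin.last (M + 1)

/-- The inverse of `vtx`. -/
def lin {M : ℕ} (v : Fin (M + 2)) : ℕ := if v.val = M + 1 then 0 else v.val + 1

theorem vtx_val {M a : ℕ} (h1 : 1 ≤ a) (h2 : a ≤ M + 1) : (vtx M a).val = a - 1 := by
  simp [vtx, h1, h2]

theorem vtx_zero_val (M : ℕ) : (vtx M 0).val = M + 1 := by simp [vtx]

theorem lin_vtx {M a : ℕ} (h : a ≤ M + 1) : lin (vtx M a) = a := by
  rcases Nat.eq_zero_or_pos a with rfl | h0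
  · simp [lin, vtx_zero_val]
  · rw [lin, vtx_val h0 h]; split_ifs <;> omega

theorem lin_le {M : ℕ} (v : Fin (M + 2)) : lin v ≤ M + 1 := by
  have := v.2
  unfold lin; split_ifs <;> omega

theorem vtx_lin {M : ℕ} (v : Fin (M + 2)) : vtx M (lin v) = v := by
  have := v.2
  ext
  unfold lin; split_ifs with h
  · rw [vtx_zero_val, h]
  · rw [vtx_val (by omega) (by omega)]; omega

theorem vtx_inj {M a b : ℕ} (ha : a ≤ M + 1) (hb : b ≤ M + 1) (h : vtx M a = vtx M b) :
    a = b := by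
  rw [← lin_vtx ha, h, lin_vtx hb]

theorem vtx_lt {M a b : ℕ} (ha : 1 ≤ a) (hb : b ≤ M + 1) (h : a < b) : vtx M a < vtx M b := by
  rw [Fin.lt_def, vtx_val ha (by omega), vtx_val (by omega) hb]; omega

theorem vtx_lt_zero {M a : ℕ} (ha : 1 ≤ a) (h : a ≤ M + 1) : vtx M a < vtx M 0 := by
  rw [Fin.lt_def, vtx_val ha (by omega), vtx_zero_val]; omega

theorem exists_vtx {M : ℕ} (v : Fin (M + 2)) : ∃ a, a ≤ M + 1 ∧ v = vtx M a :=
  ⟨lin v, lin_le v, (vtx_lin v).symm⟩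

theorem exists_chord {M : ℕ} {e : Sym2 (Fin (M + 2))} (h : ¬ e.IsDiag) :
    ∃ a b, a < b ∧ b ≤ M + 1 ∧ e = s(vtx M a, vtx M b) := by
  induction e with | _ u v
  obtain ⟨a, ha, rfl⟩ := exists_vtx u
  obtain ⟨b, hb, rfl⟩ := exists_vtx v
  rcases lt_trichotomy a b with hab | rfl | hab
  · exact ⟨a, b, hab, hb, rfl⟩
  · exact absurd (by simp) h
  · exact ⟨b, a, hab, ha, Sym2.eq_swap⟩

theorem chord_inj {M a b c d : ℕ} (hab : a < b) (hb : b ≤ M + 1) (hcd : c < d)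
    (hd : d ≤ M + 1) (h : s(vtx M a, vtx M b) = s(vtx M c, vtx M d)) : a = c ∧ b = d := by
  rcases Sym2.eq_iff.1 h with ⟨h1, h2⟩ | ⟨h1, h2⟩
  · exact ⟨vtx_inj (by omega) (by omega) h1, vtx_inj (by omega) (by omega) h2⟩
  · have := vtx_inj (by omega) (by omega) h1
    have := vtx_inj (by omega) (by omega) h2
    omega

theorem finRotate_vtx {M a : ℕ} (h : a ≤ M) : finRotate (M + 2) (vtx M a) = vtx M (a + 1) := by
  rcases Nat.eq_zero_or_pos a with rfl | h0
  · have : vtx M 0 = Fin.last (M + 1) := by simp [vtx]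
    rw [this, finRotate_last]
    ext
    rw [vtx_val (by omega) (by omega)]; simp
  · have : vtx M a = ⟨a - 1, by omega⟩ := by ext; rw [vtx_val h0 (by omega)]
    rw [this, finRotate_of_lt (by omega)]
    ext
    rw [vtx_val (by omega) (by omega)]; simp; omega

theorem finRotate_vtx_last (M : ℕ) : finRotate (M + 2) (vtx M (M + 1)) = vtx M 0 := by
  have : vtx M (M + 1) = ⟨M, by omega⟩ := by ext; rw [vtx_val (by omega) (by omega)]; simp
  rw [this, finRotate_of_lt (by omega)]
  ext
  simp [vtx_zero_val]

theorem mem_sides {M a b : ℕ} (hab : a < b) (hb : b ≤ M + 1) :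
    s(vtx M a, vtx M b) ∈ polygonSides (M + 2) ↔ b = a + 1 ∨ (a = 0 ∧ b = M + 1) := by
  simp only [polygonSides, Finset.mem_image, Finset.mem_univ, true_and]
  constructor
  · rintro ⟨i, hi⟩
    obtain ⟨c, hc, rfl⟩ := exists_vtx i
    rcases Nat.lt_or_ge c (M + 1) with h | h
    · rw [finRotate_vtx (by omega)] at hi
      have := chord_inj (by omega) (by omega) hab hb hi
      omega
    · obtain rfl : c = M + 1 := by omega
      rw [finRotate_vtx_last, Sym2.eq_swap] at hi
      have := chord_inj (by omega) (by omega) hab hb hi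
      omega
  · rintro (rfl | ⟨rfl, rfl⟩)
    · exact ⟨vtx M a, by rw [finRotate_vtx (by omega)]⟩
    · exact ⟨vtx M (M + 1), by rw [finRotate_vtx_last, Sym2.eq_swap]⟩

theorem isDiagonal_chord {M a b : ℕ} (hab : a < b) (hb : b ≤ M + 1) :
    IsDiagonal s(vtx M a, vtx M b) ↔ b ≠ a + 1 ∧ ¬ (a = 0 ∧ b = M + 1) := by
  have : vtx M a ≠ vtx M b := fun h => by
    have := vtx_inj (by omega) hb h
    omega
  simp only [IsDiagonal, mem_sides hab hb, Sym2.mk_isDiag_iff, this]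
  tauto

theorem crosses_comm {N : ℕ} {e f : Sym2 (Fin N)} (h : Crosses e f) : Crosses f e := by
  obtain ⟨a, b, c, d, h1, h2, h3, h4⟩ := h
  exact ⟨a, b, c, d, h1, h2, h3, by tauto⟩

theorem crosses_of_lt {M a b c d : ℕ} (hac : a < c) (hcb : c < b) (hbd : b < d)
    (hd : d ≤ M + 1) : Crosses s(vtx M a, vtx M b) s(vtx M c, vtx M d) := by
  rcases Nat.eq_zero_or_pos a with rfl | h0
  · exact ⟨vtx M c, vtx M b, vtx M d, vtx M 0, vtx_lt (by omega) (by omega) hcb,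
      vtx_lt (by omega) (by omega) hbd, vtx_lt_zero (by omega) hd,
      Or.inr ⟨Sym2.eq_swap, rfl⟩⟩
  · exact ⟨vtx M a, vtx M c, vtx M b, vtx M d, vtx_lt (by omega) (by omega) hac,
      vtx_lt (by omega) (by omega) hcb, vtx_lt (by omega) (by omega) hbd, Or.inl ⟨rfl, rfl⟩⟩

/-- The coordinates are the labels rotated by one place, and alternation around a circle is
invariant under rotation. -/
theorem crosses_chord {M a b c d : ℕ} (hab : a < b) (hb : b ≤ M + 1) (hcd : c < d)
    (hd : d ≤ M + 1) : Crosses s(vtx M a, vtx M b) s(vtx M c, vtx M d) ↔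
      (a < c ∧ c < b ∧ b < d) ∨ (c < a ∧ a < d ∧ d < b) := by
  constructor
  · rintro ⟨p, q, r, s, hpq, hqr, hrs, h⟩
    have key : ∀ p q r s : ℕ, p < q → q < r → r < s → s ≤ M + 1 →
        ((s(vtx M a, vtx M b) = s(vtx M p, vtx M r) ∧
          s(vtx M c, vtx M d) = s(vtx M q, vtx M s)) ∨
        (s(vtx M a, vtx M b) = s(vtx M q, vtx M s) ∧
          s(vtx M c, vtx M d) = s(vtx M p, vtx M r))) →
        (a < c ∧ c < b ∧ b < d) ∨ (c < a ∧ a < d ∧ d < b) := by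
      rintro p q r s hpq hqr hrs hs (⟨h1, h2⟩ | ⟨h1, h2⟩)
      · have := chord_inj hab hb (by omega) (by omega) h1
        have := chord_inj hcd hd (by omega) (by omega) h2
        omega
      · have := chord_inj hab hb (by omega) (by omega) h1
        have := chord_inj hcd hd (by omega) (by omega) h2
        omega
    have hs := s.2
    rw [Fin.lt_def] at hpq hqr hrs
    rcases Nat.lt_or_ge s.val (M + 1) with h' | h'
    · refine key (lin p) (lin q) (lin r) (lin s) ?_ ?_ ?_ (lin_le s) (by simpa only [vtx_lin])
      all_goals unfold lin; split_ifs <;> omega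
    -- Here `s` has the largest label, hence coordinate `0`; it moves to the front and the two pairs
    -- exchange roles.
    · refine key (lin s) (lin p) (lin q) (lin r) ?_ ?_ ?_ (lin_le r) ?_
      iterate 3 unfold lin; split_ifs <;> omega
      simp only [vtx_lin]
      rw [Sym2.eq_swap (a := s) (b := q)]
      tauto
  · rintro (h | h)
    · exact crosses_of_lt h.1 h.2.1 h.2.2 hd
    · exact crosses_comm (crosses_of_lt h.1 h.2.1 h.2.2 hb)

/-! ### Visible chords and region orders. -/

/-- All values of `q` strictly between `a` and `b` are smaller than `q a` and `q b`. -/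
def Vis (q : ℕ → ℕ) (a b : ℕ) : Prop :=
  a < b ∧ ∀ c, a < c → c < b → q c < q a ∧ q c < q b

open Classical in
/-- The diagonals of the `(M + 2)`-gon that join mutually visible vertices of the height
function `q`. -/
noncomputable def chordsOf (M : ℕ) (q : ℕ → ℕ) : Finset (Sym2 (Fin (M + 2))) :=
  Finset.univ.filter fun e => IsDiagonal e ∧
    ∃ a b, b ≤ M + 1 ∧ e = s(vtx M a, vtx M b) ∧ Vis q a b

/-- `q` lists, for every inner vertex `1, …, M`, the rank of the region below it in the
left-to-right postorder of the `k` regions of a dissection. -/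
structure IsRegionOrder (M k : ℕ) (q : ℕ → ℕ) : Prop where
  top : ∀ a, a = 0 ∨ M < a → q a = k
  lt : ∀ a, 1 ≤ a → a ≤ M → q a < k
  avoid : ∀ x c y, 1 ≤ x → x < c → c < y → y ≤ M → q y ≤ q x → q c ≤ q x
  surj : ∀ r, r < k → ∃ a, 1 ≤ a ∧ a ≤ M ∧ q a = r

theorem mem_chordsOf {M a b : ℕ} {q : ℕ → ℕ} (hab : a < b) (hb : b ≤ M + 1) :
    s(vtx M a, vtx M b) ∈ chordsOf M q ↔
      b ≠ a + 1 ∧ ¬ (a = 0 ∧ b = M + 1) ∧ Vis q a b := by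
  simp only [chordsOf, Finset.mem_filter, Finset.mem_univ, true_and, isDiagonal_chord hab hb]
  constructor
  · rintro ⟨h, c, d, hd, he, hv⟩
    obtain ⟨rfl, rfl⟩ := chord_inj hab hb hv.1 hd he
    exact ⟨h.1, h.2, hv⟩
  · rintro ⟨h1, h2, h3⟩
    exact ⟨⟨h1, h2⟩, a, b, hb, rfl, h3⟩

theorem exists_of_mem_chordsOf {M : ℕ} {q : ℕ → ℕ} {e : Sym2 (Fin (M + 2))}
    (he : e ∈ chordsOf M q) : ∃ a b, b ≤ M + 1 ∧ e = s(vtx M a, vtx M b) ∧ Vis q a b := by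
  simp only [chordsOf, Finset.mem_filter] at he
  exact he.2.2

theorem isDiagonal_of_mem_chordsOf {M : ℕ} {q : ℕ → ℕ} {e : Sym2 (Fin (M + 2))}
    (he : e ∈ chordsOf M q) : IsDiagonal e := by
  simp only [chordsOf, Finset.mem_filter] at he
  exact he.2.1

/-- If visible chords `(a, b)` and `(c, d)` had `a < c < b < d`, the first would give `q c < q b`
and the second `q b < q c`. -/
theorem isDissection_chordsOf (M : ℕ) (q : ℕ → ℕ) : IsDissection (chordsOf M q) := by
  refine ⟨fun e he => isDiagonal_of_mem_chordsOf he, fun e he f hf hc => ?_⟩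
  obtain ⟨a, b, hb, rfl, hv⟩ := exists_of_mem_chordsOf he
  obtain ⟨c, d, hd, rfl, hw⟩ := exists_of_mem_chordsOf hf
  rcases (crosses_chord hv.1 hb hw.1 hd).1 hc with ⟨h1, h2, h3⟩ | ⟨h1, h2, h3⟩
  · have := hv.2 c h1 h2
    have := hw.2 b h2 h3
    omega
  · have := hv.2 d h2 h3
    have := hw.2 a h1 h2
    omega

/-- `(a, b)` is the chord that bounds the region of rank `r` from above. -/
def Base (q : ℕ → ℕ) (r a b : ℕ) : Prop :=
  (∃ x, a < x ∧ x < b ∧ q x = r) ∧ (∀ c, a < c → c < b → q c ≤ r) ∧ r < q a ∧ r < q b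

theorem Base.vis {q : ℕ → ℕ} {r a b : ℕ} (h : Base q r a b) : Vis q a b := by
  obtain ⟨⟨x, h1, h2, h3⟩, h4, h5, h6⟩ := h
  refine ⟨by omega, fun c hc hc' => ?_⟩
  have := h4 c hc hc'
  omega

theorem Base.two_le {q : ℕ → ℕ} {r a b : ℕ} (h : Base q r a b) : a + 2 ≤ b := by
  obtain ⟨⟨x, h1, h2, h3⟩, h4, h5, h6⟩ := h
  omega

theorem Base.rank_unique {q : ℕ → ℕ} {r r' a b : ℕ} (h : Base q r a b) (h' : Base q r' a b) :
    r = r' := by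
  obtain ⟨⟨x, h1, h2, rfl⟩, h4, -⟩ := h
  obtain ⟨⟨y, g1, g2, rfl⟩, g4, -⟩ := h'
  exact le_antisymm (g4 x h1 h2) (h4 y g1 g2)

theorem Vis.exists_base {q : ℕ → ℕ} {a b : ℕ} (h : Vis q a b) (h2 : a + 2 ≤ b) :
    ∃ r, Base q r a b := by
  obtain ⟨x, hx, hm⟩ := Finset.exists_max_image (Finset.Ioo a b) q
    ⟨a + 1, by simp only [Finset.mem_Ioo]; omega⟩
  simp only [Finset.mem_Ioo] at hx hm
  exact ⟨q x, ⟨x, hx.1, hx.2, rfl⟩, fun c h3 h4 => hm c ⟨h3, h4⟩, h.2 x hx.1 hx.2⟩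

/-- The last index before `x` where `P` holds. -/
theorem exists_last_before {P : ℕ → Prop} {x a : ℕ} (ha : P a) (hax : a < x) :
    ∃ b, a ≤ b ∧ b < x ∧ P b ∧ ∀ c, b < c → c < x → ¬ P c := by
  classical
  have hP : P (Nat.findGreatest P (x - 1)) := Nat.findGreatest_spec (by omega) ha
  have hle : Nat.findGreatest P (x - 1) ≤ x - 1 := Nat.findGreatest_le _
  have hge : a ≤ Nat.findGreatest P (x - 1) := Nat.le_findGreatest (by omega) ha
  exact ⟨_, hge, by omega, hP, fun c h1 h2 => Nat.findGreatest_is_greatest h1 (by omega)⟩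

/-- The first index after `x` where `P` holds. -/
theorem exists_first_after {P : ℕ → Prop} {x b : ℕ} (hb : P b) (hxb : x < b) :
    ∃ a, x < a ∧ a ≤ b ∧ P a ∧ ∀ c, x < c → c < a → ¬ P c := by
  classical
  have hex : ∃ a, x < a ∧ P a := ⟨b, hxb, hb⟩
  refine ⟨Nat.find hex, (Nat.find_spec hex).1, Nat.find_min' hex ⟨hxb, hb⟩,
    (Nat.find_spec hex).2, fun c h1 h2 h3 => Nat.find_min hex h2 ⟨h1, h3⟩⟩

namespace IsRegionOrder

variable {M k : ℕ} {q : ℕ → ℕ}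

/-- The ends are the nearest higher vertices on both sides of `x`; the outer vertices, of height
`k`, ensure that they exist. -/
theorem exists_base_around (h : IsRegionOrder M k q) {x : ℕ} (h1 : 1 ≤ x) (h2 : x ≤ M) :
    ∃ a b, a < x ∧ x < b ∧ b ≤ M + 1 ∧ Base q (q x) a b := by
  have hx := h.lt x h1 h2
  obtain ⟨a, -, ha, ha', ha''⟩ := exists_last_before (P := fun a => q x < q a) (x := x) (a := 0)
    (by simpa [h.top 0] using hx) (by omega)
  obtain ⟨b, hb, hbM, hb', hb''⟩ := exists_first_after (P := fun a => q x < q a) (x := x)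
    (b := M + 1) (by simpa [h.top (M + 1)] using hx) (by omega)
  refine ⟨a, b, ha, hb, hbM, ⟨x, ha, hb, rfl⟩, fun c h3 h4 => ?_, ha', hb'⟩
  rcases lt_trichotomy c x with h5 | rfl | h5
  · exact not_lt.1 (ha'' c h3 h5)
  · exact le_rfl
  · exact not_lt.1 (hb'' c h5 h4)

/-- By `avoid`, nothing between two vertices of rank `r` exceeds `r`. So no end of a base separates
the two witnesses, and no end of one base lies strictly inside the other. -/
theorem base_unique (h : IsRegionOrder M k q) {r a b a' b' : ℕ} (hb : b ≤ M + 1)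
    (hb' : b' ≤ M + 1) (H : Base q r a b) (H' : Base q r a' b') : a = a' ∧ b = b' := by
  obtain ⟨⟨x, h1, h2, h3⟩, h4, h5, h6⟩ := H
  obtain ⟨⟨y, g1, g2, g3⟩, g4, g5, g6⟩ := H'
  have hmid : ∀ c, x < c → c < y → q c ≤ r := fun c i1 i2 => by
    have := h.avoid x c y (by omega) i1 i2 (by omega) (by omega)
    omega
  have hmid' : ∀ c, y < c → c < x → q c ≤ r := fun c i1 i2 => by
    have := h.avoid y c x (by omega) i1 i2 (by omega) (by omega)
    omega
  have ha' : ¬ (x ≤ a' ∧ a' ≤ y) := fun i => by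
    rcases eq_or_lt_of_le i.1 with j | j
    · subst j; omega
    · have := hmid a' j g1; omega
  have hb' : ¬ (y ≤ b' ∧ b' ≤ x) := fun i => by
    rcases eq_or_lt_of_le i.2 with j | j
    · subst j; omega
    · have := hmid' b' g2 j; omega
  have ha : ¬ (y ≤ a ∧ a ≤ x) := fun i => by
    rcases eq_or_lt_of_le i.1 with j | j
    · subst j; omega
    · have := hmid' a j h1; omega
  have hb : ¬ (x ≤ b ∧ b ≤ y) := fun i => by
    rcases eq_or_lt_of_le i.2 with j | j
    · subst j; omega
    · have := hmid b h2 j; omega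
  have e1 : ¬ (a < a' ∧ a' < b) := fun i => by have := h4 a' i.1 i.2; omega
  have e2 : ¬ (a' < a ∧ a < b') := fun i => by have := g4 a i.1 i.2; omega
  have e3 : ¬ (a < b' ∧ b' < b) := fun i => by have := h4 b' i.1 i.2; omega
  have e4 : ¬ (a' < b ∧ b < b') := fun i => by have := g4 b i.1 i.2; omega
  omega

/-- Sending a rank to its unique base is a bijection from the `k` ranks to the diagonals together
with the root side. -/
theorem card_chordsOf (h : IsRegionOrder M k q) (hM : 1 ≤ M) : (chordsOf M q).card + 1 = k := by
  classical
  have hex : ∀ r, ∃ a b, r < k → b ≤ M + 1 ∧ Base q r a b := fun r => by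
    by_cases hr : r < k
    · obtain ⟨x, h1, h2, rfl⟩ := h.surj r hr
      obtain ⟨a, b, -, -, h3, h4⟩ := h.exists_base_around h1 h2
      exact ⟨a, b, fun _ => ⟨h3, h4⟩⟩
    · exact ⟨0, 0, fun h => absurd h hr⟩
  choose A B hAB using hex
  have hroot : s(vtx M 0, vtx M (M + 1)) ∉ chordsOf M q := fun hc => by
    rw [mem_chordsOf (by omega) le_rfl] at hc
    exact hc.2.1 ⟨rfl, rfl⟩
  rw [← Finset.card_insert_of_notMem hroot, ← Finset.card_range k]
  symm
  refine Finset.card_bij (fun r _ => s(vtx M (A r), vtx M (B r))) ?_ ?_ ?_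
  · intro r hr
    obtain ⟨h1, h2⟩ := hAB r (Finset.mem_range.1 hr)
    have := h2.two_le
    rw [Finset.mem_insert, mem_chordsOf (by omega) h1]
    by_cases hc : A r = 0 ∧ B r = M + 1
    · exact Or.inl (by rw [hc.1, hc.2])
    · exact Or.inr ⟨by omega, hc, h2.vis⟩
  · intro r hr r' hr' he
    obtain ⟨h1, h2⟩ := hAB r (Finset.mem_range.1 hr)
    obtain ⟨h1', h2'⟩ := hAB r' (Finset.mem_range.1 hr')
    obtain ⟨e1, e2⟩ := chord_inj h2.vis.1 h1 h2'.vis.1 h1' he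
    exact h2.rank_unique (by rwa [e1, e2])
  · intro e he
    have : ∃ a b, b ≤ M + 1 ∧ e = s(vtx M a, vtx M b) ∧ Vis q a b ∧ a + 2 ≤ b := by
      rcases Finset.mem_insert.1 he with rfl | he
      · refine ⟨0, M + 1, le_rfl, rfl, ⟨by omega, fun c h1 h2 => ?_⟩, by omega⟩
        have := h.lt c (by omega) (by omega)
        rw [h.top 0 (by omega), h.top (M + 1) (by omega)]
        exact ⟨this, this⟩
      · obtain ⟨a, b, h1, rfl, h3⟩ := exists_of_mem_chordsOf he
        have := (mem_chordsOf h3.1 h1).1 he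
        have := h3.1
        exact ⟨a, b, h1, rfl, h3, by omega⟩
    obtain ⟨a, b, h1, rfl, h3, h4⟩ := this
    obtain ⟨r, hr⟩ := h3.exists_base h4
    have hrk : r < k := by
      obtain ⟨⟨x, i1, i2, rfl⟩, -⟩ := hr
      exact h.lt x (by omega) (by omega)
    obtain ⟨j1, j2⟩ := hAB r hrk
    obtain ⟨e1, e2⟩ := h.base_unique j1 h1 j2 hr
    exact ⟨r, Finset.mem_range.2 hrk, by rw [e1, e2]⟩

end IsRegionOrder

/-! ### The dissection determines its region order. -/

/-- The chord `(a, b)` is the root side or belongs to `E`. -/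
def InHull {M : ℕ} (E : Finset (Sym2 (Fin (M + 2)))) (a b : ℕ) : Prop :=
  a < b ∧ b ≤ M + 1 ∧ (s(vtx M a, vtx M b) ∈ E ∨ (a = 0 ∧ b = M + 1))

theorem inHull_chordsOf {M k : ℕ} {q : ℕ → ℕ} (h : IsRegionOrder M k q) (hM : 1 ≤ M) {a b : ℕ} :
    InHull (chordsOf M q) a b ↔ b ≤ M + 1 ∧ a + 2 ≤ b ∧ Vis q a b := by
  constructor
  · rintro ⟨h1, h2, h3⟩
    rw [mem_chordsOf h1 h2] at h3
    rcases h3 with h3 | ⟨rfl, rfl⟩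
    · exact ⟨h2, by omega, h3.2.2⟩
    · refine ⟨h2, by omega, by omega, fun c h3 h4 => ?_⟩
      have := h.lt c (by omega) (by omega)
      rw [h.top 0 (by omega), h.top (M + 1) (by omega)]
      exact ⟨this, this⟩
  · rintro ⟨h1, h2, h3⟩
    refine ⟨h3.1, h1, ?_⟩
    rw [mem_chordsOf h3.1 h1]
    by_cases hc : a = 0 ∧ b = M + 1
    · exact Or.inr hc
    · exact Or.inl ⟨by omega, hc, h3⟩

namespace IsRegionOrder

variable {M k : ℕ} {q : ℕ → ℕ}

/-- Comparisons of heights can be read off from the chords alone. The base over `x` must end by `y`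
if `y` is higher; conversely its right end is higher than `x`, and `avoid` forbids `y` to be as low
as `x` behind it. -/
theorem lt_iff_sep (h : IsRegionOrder M k q) (hM : 1 ≤ M) {x y : ℕ} (hx : 1 ≤ x) (hxy : x < y)
    (hy : y ≤ M) : q x < q y ↔ ∃ a b, InHull (chordsOf M q) a b ∧ a < x ∧ x < b ∧ b ≤ y := by
  simp only [inHull_chordsOf h hM]
  constructor
  · intro hlt
    obtain ⟨a, b, h1, h2, h3, h4⟩ := h.exists_base_around hx (by omega)
    refine ⟨a, b, ⟨h3, h4.two_le, h4.vis⟩, h1, h2, ?_⟩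
    by_contra hc
    have := h4.2.1 y (by omega) (by omega)
    omega
  · rintro ⟨a, b, ⟨h1, h2, h3⟩, h4, h5, h6⟩
    have := (h3.2 x h4 h5).2
    rcases eq_or_lt_of_le h6 with rfl | h6
    · exact this
    · have := h.avoid x b y hx h5 h6 hy
      omega

/-- A chord over `y` but not over `x` is not enough by itself, since `x` may have been cut off
earlier in the postorder; hence the first conjunct. -/
theorem gt_iff_sep (h : IsRegionOrder M k q) (hM : 1 ≤ M) {x y : ℕ} (hx : 1 ≤ x) (hxy : x < y)
    (hy : y ≤ M) : q y < q x ↔ ¬ q x < q y ∧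
      ∃ a b, InHull (chordsOf M q) a b ∧ x ≤ a ∧ a < y ∧ y < b := by
  simp only [inHull_chordsOf h hM]
  constructor
  · intro hlt
    refine ⟨by omega, ?_⟩
    obtain ⟨a, b, h1, h2, h3, h4⟩ := h.exists_base_around (x := y) (by omega) hy
    refine ⟨a, b, ⟨h3, h4.two_le, h4.vis⟩, ?_, h1, h2⟩
    by_contra hc
    have := h4.2.1 x (by omega) (by omega)
    omega
  · rintro ⟨hn, a, b, ⟨h1, h2, h3⟩, h4, h5, h6⟩
    have := (h3.2 y h5 h6).1
    rcases eq_or_lt_of_le h4 with rfl | h4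
    · exact this
    · have := h.avoid x a y hx h4 h5 hy
      omega

/-- Since `q` omits no rank, a vertex of rank `r` ends a chain of `r` strict increases, which `q'`
preserves. -/
theorem le_of_lt_imp {q' : ℕ → ℕ} (h : IsRegionOrder M k q)
    (H : ∀ x y, 1 ≤ x → x ≤ M → 1 ≤ y → y ≤ M → q x < q y → q' x < q' y) :
    ∀ r x, 1 ≤ x → x ≤ M → q x = r → r ≤ q' x := by
  intro r
  induction r with
  | zero => intros; omega
  | succ r ih =>
    intro x h1 h2 h3
    have := h.lt x h1 h2
    obtain ⟨y, g1, g2, g3⟩ := h.surj r (by omega)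
    have := H y x g1 g2 h1 h2 (by omega)
    have := ih y g1 g2 g3
    omega

theorem eq_of_lt_iff {q' : ℕ → ℕ} (h : IsRegionOrder M k q) (h' : IsRegionOrder M k q')
    (H : ∀ x y, 1 ≤ x → x ≤ M → 1 ≤ y → y ≤ M → (q x < q y ↔ q' x < q' y)) : q = q' := by
  funext x
  by_cases hx : x = 0 ∨ M < x
  · rw [h.top x hx, h'.top x hx]
  · exact le_antisymm
      (h.le_of_lt_imp (fun x y a b c d => (H x y a b c d).1) _ x (by omega) (by omega) rfl)
      (h'.le_of_lt_imp (fun x y a b c d => (H x y a b c d).2) _ x (by omega) (by omega) rfl)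

theorem eq_of_chordsOf_eq {q' : ℕ → ℕ} (h : IsRegionOrder M k q) (h' : IsRegionOrder M k q')
    (hM : 1 ≤ M) (he : chordsOf M q = chordsOf M q') : q = q' := by
  have H : ∀ x y, 1 ≤ x → x < y → y ≤ M →
      (q x < q y ↔ q' x < q' y) ∧ (q y < q x ↔ q' y < q' x) := fun x y h1 h2 h3 => by
    have e : q x < q y ↔ q' x < q' y := by
      rw [h.lt_iff_sep hM h1 h2 h3, h'.lt_iff_sep hM h1 h2 h3, he]
    exact ⟨e, by rw [h.gt_iff_sep hM h1 h2 h3, h'.gt_iff_sep hM h1 h2 h3, he, e]⟩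
  refine h.eq_of_lt_iff h' fun x y h1 h2 h3 h4 => ?_
  rcases lt_trichotomy x y with i | rfl | i
  · exact (H x y h1 i h4).1
  · simp
  · exact (H y x h3 i h2).2

end IsRegionOrder

/-! ### Every dissection has a region order. -/

theorem chordsOf_congr {M : ℕ} {q q' : ℕ → ℕ}
    (h : ∀ x y, x ≤ M + 1 → y ≤ M + 1 → (q x < q y ↔ q' x < q' y)) :
    chordsOf M q = chordsOf M q' := by
  have hv : ∀ a b, b ≤ M + 1 → (Vis q a b ↔ Vis q' a b) := fun a b hb => by
    refine and_congr_right fun hab => forall_congr' fun c => ?_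
    refine forall_congr' fun h1 => forall_congr' fun h2 => ?_
    rw [h c a (by omega) (by omega), h c b (by omega) (by omega)]
  ext e
  simp only [chordsOf, Finset.mem_filter, Finset.mem_univ, true_and]
  refine and_congr_right fun _ => exists_congr fun a => exists_congr fun b => ?_
  refine and_congr_right fun hb => and_congr_right fun _ => hv a b hb

open Classical in
/-- The postorder rank of a chord; it is monotone for the lexicographic order of `(b, -a)`. -/
noncomputable def chordHeight {M : ℕ} (E : Finset (Sym2 (Fin (M + 2)))) (x : ℕ) : ℕ :=
  if 1 ≤ x ∧ x ≤ M then
    sInf {m | ∃ a b, InHull E a b ∧ a < x ∧ x < b ∧ m = b * (M + 2) + (M + 1 - a)}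
  else (M + 2) * (M + 2)

section Height

variable {M : ℕ} {E : Finset (Sym2 (Fin (M + 2)))}

/-- The pair is written in base `M + 2` with last digit `M + 1 - a`, so comparison of numbers is
lexicographic. -/
theorem key_lt {a b a' b' : ℕ} (ha : a ≤ M + 1) (ha' : a' ≤ M + 1)
    (h : b < b' ∨ (b = b' ∧ a' < a)) :
    b * (M + 2) + (M + 1 - a) < b' * (M + 2) + (M + 1 - a') := by
  rcases h with h | ⟨rfl, h⟩
  · have : (b + 1) * (M + 2) ≤ b' * (M + 2) := Nat.mul_le_mul_right _ h
    have : (b + 1) * (M + 2) = b * (M + 2) + (M + 2) := by ring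
    omega
  · omega

theorem chordHeight_spec {x : ℕ} (h1 : 1 ≤ x) (h2 : x ≤ M) :
    ∃ a b, InHull E a b ∧ a < x ∧ x < b ∧ chordHeight E x = b * (M + 2) + (M + 1 - a) := by
  have hne : {m | ∃ a b, InHull E a b ∧ a < x ∧ x < b ∧
      m = b * (M + 2) + (M + 1 - a)}.Nonempty :=
    -- The root side passes over every inner vertex.
    ⟨_, 0, M + 1, ⟨by omega, le_rfl, Or.inr ⟨rfl, rfl⟩⟩, by omega, by omega, rfl⟩
  have := Nat.sInf_mem hne
  rw [chordHeight, if_pos ⟨h1, h2⟩]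
  exact this

theorem chordHeight_le {x a b : ℕ} (h1 : InHull E a b) (h2 : a < x) (h3 : x < b) :
    chordHeight E x ≤ b * (M + 2) + (M + 1 - a) := by
  have := h1.2.1
  rw [chordHeight, if_pos ⟨by omega, by omega⟩]
  exact Nat.sInf_le ⟨a, b, h1, h2, h3, rfl⟩

theorem chordHeight_lt {x : ℕ} (h1 : 1 ≤ x) (h2 : x ≤ M) :
    chordHeight E x < (M + 2) * (M + 2) := by
  obtain ⟨a, b, h3, h4, h5, h6⟩ := chordHeight_spec (E := E) h1 h2
  have := h3.2.1
  have : (b + 1) * (M + 2) ≤ (M + 2) * (M + 2) := Nat.mul_le_mul_right _ (by omega)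
  have : (b + 1) * (M + 2) = b * (M + 2) + (M + 2) := by ring
  omega

theorem chordHeight_top {x : ℕ} (h : x = 0 ∨ M < x) : chordHeight E x = (M + 2) * (M + 2) := by
  rw [chordHeight, if_neg (by omega)]

/-- A vertex that is not strictly before the right end of a chord lies above that chord. -/
theorem lt_chordHeight_right {a b y : ℕ} (h : InHull E a b) (hy : b ≤ y) :
    b * (M + 2) + (M + 1 - a) < chordHeight E y := by
  obtain ⟨h1, h2, -⟩ := h
  by_cases hyM : y ≤ M
  · obtain ⟨c, d, h3, h4, h5, h6⟩ := chordHeight_spec (E := E) (x := y) (by omega) hyM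
    rw [h6]
    have := h3.2.1
    exact key_lt (by omega) (by omega) (Or.inl (by omega))
  · rw [chordHeight_top (by omega)]
    have : (b + 1) * (M + 2) ≤ (M + 2) * (M + 2) := Nat.mul_le_mul_right _ (by omega)
    have : (b + 1) * (M + 2) = b * (M + 2) + (M + 2) := by ring
    omega

theorem InHull.noncrossing (hE : IsDissection E) {a b c d : ℕ} (h : InHull E a b)
    (h' : InHull E c d) : ¬ (a < c ∧ c < b ∧ b < d) := fun hc => by
  obtain ⟨h1, h2, h3⟩ := h
  obtain ⟨g1, g2, g3⟩ := h'
  rcases h3 with h3 | h3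
  · rcases g3 with g3 | g3
    · exact hE.2 _ h3 _ g3 ((crosses_chord h1 h2 g1 g2).2 (Or.inl hc))
    · omega
  · omega

/-- A chord over `a` starts further left and, by noncrossing, ends no earlier than `b`, so it comes
later in postorder. -/
theorem lt_chordHeight_left (hE : IsDissection E) {a b : ℕ} (h : InHull E a b) :
    b * (M + 2) + (M + 1 - a) < chordHeight E a := by
  have h1 := h.1
  have h2 := h.2.1
  rcases Nat.eq_zero_or_pos a with rfl | ha
  · rw [chordHeight_top (by omega)]
    have : (b + 1) * (M + 2) ≤ (M + 2) * (M + 2) := Nat.mul_le_mul_right _ (by omega)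
    have : (b + 1) * (M + 2) = b * (M + 2) + (M + 2) := by ring
    omega
  · obtain ⟨c, d, h3, h4, h5, h6⟩ := chordHeight_spec (E := E) (x := a) ha (by omega)
    rw [h6]
    have := h3.noncrossing hE h
    exact key_lt (by omega) (by omega) (by omega)

/-- The lowest chord over `x` either ends by `y`, which makes `y` higher than `x`, or also passes
over `c`. -/
theorem chordHeight_avoid {x c y : ℕ} (h1 : 1 ≤ x) (h2 : x < c) (h3 : c < y) (h4 : y ≤ M)
    (h : chordHeight E y ≤ chordHeight E x) : chordHeight E c ≤ chordHeight E x := by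
  obtain ⟨a, b, h5, h6, h7, h8⟩ := chordHeight_spec (E := E) (x := x) h1 (by omega)
  by_cases hb : b ≤ y
  · have := lt_chordHeight_right h5 hb
    omega
  · rw [h8]
    exact chordHeight_le h5 (by omega) (by omega)

/-- Inside a visible pair take a highest vertex `x` and its lowest chord `(c, d)`. If that chord
covered an end of the pair, this end would be no higher than `x`; if `c` or `d` were inside, it
would be higher than `x`. Hence it joins the pair. -/
theorem chordsOf_chordHeight (hE : IsDissection E) : chordsOf M (chordHeight E) = E := by
  ext e
  by_cases hd : IsDiagonal e
  swap
  · exact ⟨fun h => absurd (isDiagonal_of_mem_chordsOf h) hd, fun h => absurd (hE.1 e h) hd⟩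
  obtain ⟨a, b, hab, hb, rfl⟩ := exists_chord hd.1
  have hd' := (isDiagonal_chord hab hb).1 hd
  rw [mem_chordsOf hab hb]
  constructor
  · rintro ⟨h1, h2, h3⟩
    obtain ⟨r, ⟨x, i1, i2, rfl⟩, i3, i4, i5⟩ := h3.exists_base (by omega)
    obtain ⟨c, d, j1, j2, j3, j4⟩ := chordHeight_spec (E := E) (x := x) (by omega) (by omega)
    have hac : ¬ c < a := fun h => by
      have := chordHeight_le j1 h (by omega)
      omega
    have hbd : ¬ b < d := fun h => by
      have := chordHeight_le j1 (x := b) (by omega) h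
      omega
    have hca : ¬ a < c := fun h => by
      have := lt_chordHeight_left hE j1
      have := i3 c h (by omega)
      omega
    have hdb : ¬ d < b := fun h => by
      have := lt_chordHeight_right j1 le_rfl
      have := i3 d (by omega) h
      omega
    obtain rfl : a = c := by omega
    obtain rfl : b = d := by omega
    rcases j1.2.2 with h | h
    · exact h
    · exact absurd h h2
  · intro h
    have hin : InHull E a b := ⟨hab, hb, Or.inl h⟩
    refine ⟨hd'.1, hd'.2, hab, fun c h1 h2 => ?_⟩
    have := chordHeight_le hin h1 h2
    have := lt_chordHeight_left hE hin
    have := lt_chordHeight_right hin le_rfl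
    omega

end Height

/-- Every height function without the forbidden pattern is order equivalent to a
normalized one. -/
theorem exists_isRegionOrder_of_avoid {M K : ℕ} {κ : ℕ → ℕ} (top : ∀ a, a = 0 ∨ M < a → κ a = K)
    (lt : ∀ a, 1 ≤ a → a ≤ M → κ a < K)
    (avoid : ∀ x c y, 1 ≤ x → x < c → c < y → y ≤ M → κ y ≤ κ x → κ c ≤ κ x) :
    ∃ q, IsRegionOrder M ((Finset.Icc 1 M).image κ).card q ∧ ∀ x y, (q x < q y ↔ κ x < κ y) := by
  set I := (Finset.Icc 1 M).image κ with hI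
  have hmem : ∀ x, κ x < K → κ x ∈ I := fun x hx => by
    refine Finset.mem_image_of_mem _ (Finset.mem_Icc.2 ?_)
    by_contra hc
    have := top x (by omega)
    omega
  have hle : ∀ x, κ x ≤ K := fun x => by
    by_cases h : x = 0 ∨ M < x
    · exact (top x h).le
    · exact (lt x (by omega) (by omega)).le
  -- Replace each height by the number of inner heights below it.
  set q : ℕ → ℕ := fun x => (I.filter (· < κ x)).card with hq
  have hmono : ∀ x y, κ x < κ y → q x < q y := fun x y h => by
    refine Finset.card_lt_card ⟨fun m hm => ?_, fun hs => ?_⟩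
    · simp only [Finset.mem_filter] at hm ⊢
      exact ⟨hm.1, by omega⟩
    · have := hs (Finset.mem_filter.2 ⟨hmem x (by have := hle y; omega), h⟩)
      simp at this
  have hqlt : ∀ x y, q x < q y ↔ κ x < κ y := fun x y => by
    refine ⟨fun h => ?_, hmono x y⟩
    rcases lt_trichotomy (κ x) (κ y) with i | i | i
    · exact i
    · simp only [hq, i] at h; omega
    · have := hmono y x i; omega
  have htop : ∀ a, a = 0 ∨ M < a → q a = I.card := fun a ha => by
    rw [hq]
    refine congrArg Finset.card (Finset.filter_true_of_mem (p := (· < κ a)) fun m hm => ?_)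
    obtain ⟨x, hx, rfl⟩ := Finset.mem_image.1 hm
    rw [Finset.mem_Icc] at hx
    rw [top a ha]
    exact lt x hx.1 hx.2
  have hlt : ∀ a, 1 ≤ a → a ≤ M → q a < I.card := fun a h1 h2 => by
    rw [← htop 0 (Or.inl rfl), hqlt, top 0 (Or.inl rfl)]
    exact lt a h1 h2
  refine ⟨q, ⟨htop, hlt, fun x c y h1 h2 h3 h4 h5 => ?_, fun r hr => ?_⟩, hqlt⟩
  · rw [← not_lt, hqlt, not_lt] at h5 ⊢
    exact avoid x c y h1 h2 h3 h4 h5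
  -- No rank is omitted: the image lies in a set of size `I.card` and has as many elements, as
  -- distinct heights have distinct ranks.
  · have himg : ((Finset.Icc 1 M).image q) = Finset.range I.card := by
      refine Finset.eq_of_subset_of_card_le (fun m hm => ?_) ?_
      · obtain ⟨x, hx, rfl⟩ := Finset.mem_image.1 hm
        rw [Finset.mem_Icc] at hx
        exact Finset.mem_range.2 (hlt x hx.1 hx.2)
      · have : (Finset.Icc 1 M).image q = I.image fun m => (I.filter (· < m)).card := by
          rw [hI, Finset.image_image]; rfl
        rw [Finset.card_range, this]
        refine (Finset.card_image_of_injOn fun m hm m' hm' he => ?_).ge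
        obtain ⟨x, hx, rfl⟩ := Finset.mem_image.1 hm
        obtain ⟨y, hy, rfl⟩ := Finset.mem_image.1 hm'
        have h1 := hqlt x y
        have h2 := hqlt y x
        simp only [hq] at h1 h2
        omega
    have := himg ▸ Finset.mem_range.2 hr
    obtain ⟨x, hx, rfl⟩ := Finset.mem_image.1 this
    rw [Finset.mem_Icc] at hx
    exact ⟨x, hx.1, hx.2, rfl⟩

/-- Every dissection is the set of visible chords of its region order. -/
theorem exists_isRegionOrder {M : ℕ} (hM : 1 ≤ M) {E : Finset (Sym2 (Fin (M + 2)))}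
    (hE : IsDissection E) : ∃ q, IsRegionOrder M (E.card + 1) q ∧ chordsOf M q = E := by
  obtain ⟨q, h1, h2⟩ := exists_isRegionOrder_of_avoid (M := M) (κ := chordHeight E)
    (fun a h => chordHeight_top h) (fun a h h' => chordHeight_lt h h')
    (fun x c y h1 h2 h3 h4 h5 => chordHeight_avoid h1 h2 h3 h4 h5)
  have he : chordsOf M q = E := by
    rw [chordsOf_congr fun x y _ _ => h2 x y, chordsOf_chordHeight hE]
  refine ⟨q, ?_, he⟩
  have := h1.card_chordsOf hM
  rw [he] at this
  rwa [this]

/-! ### Triangulations and their clip sequences. -/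

section Clip

variable {n : ℕ} {π : Equiv.Perm (Fin n)}

/-- The step at which the vertex `vtx n a` is deleted, and `n` if it never is. -/
def time (π : Equiv.Perm (Fin n)) (a : ℕ) : ℕ :=
  if h : 1 ≤ a ∧ a ≤ n then (π.symm ⟨a - 1, by omega⟩).val else n

theorem time_entry (π : Equiv.Perm (Fin n)) (i : Fin n) : time π ((π i).val + 1) = i := by
  have := (π i).2
  rw [time, dif_pos ⟨by omega, by omega⟩]
  simp

theorem time_outer {a : ℕ} (h : a = 0 ∨ n < a) : time π a = n := by
  rw [time, dif_neg (by omega)]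

theorem time_lt {a : ℕ} (h1 : 1 ≤ a) (h2 : a ≤ n) : time π a < n := by
  rw [time, dif_pos ⟨h1, h2⟩]; exact Fin.is_lt _

theorem time_le (π : Equiv.Perm (Fin n)) (a : ℕ) : time π a ≤ n := by
  unfold time; split_ifs <;> omega

theorem inner_of_time_lt {a : ℕ} (h : time π a < n) : 1 ≤ a ∧ a ≤ n := by
  by_contra hc
  rw [time_outer (by omega)] at h
  omega

theorem entry_time {a : ℕ} (h : time π a < n) : (π ⟨time π a, h⟩).val + 1 = a := by
  obtain ⟨h1, h2⟩ := inner_of_time_lt h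
  have : (⟨time π a, h⟩ : Fin n) = π.symm ⟨a - 1, by omega⟩ := by
    ext; simp [time, h1, h2]
  rw [this, Equiv.apply_symm_apply]
  simp; omega

theorem time_inj {a b : ℕ} (h : time π a = time π b) (ha : time π a < n) : a = b := by
  have h1 := entry_time ha
  have h2 := entry_time (h ▸ ha)
  simp only [h] at h1
  omega

theorem exists_entry {a : ℕ} (h1 : 1 ≤ a) (h2 : a ≤ n) : ∃ i : Fin n, a = (π i).val + 1 :=
  ⟨⟨time π a, time_lt h1 h2⟩, (entry_time _).symm⟩

/-- In an occurrence the letters `3`, `1`, `2` are `y`, `x`, `c`, deleted in this order. -/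
theorem avoids312_iff : Avoids312 π ↔ ∀ x c y, 1 ≤ x → x < c → c < y → y ≤ n →
    time π y ≤ time π x → time π c ≤ time π x := by
  constructor
  · intro h x c y h1 h2 h3 h4 h5
    obtain ⟨i, rfl⟩ := exists_entry (π := π) (a := x) (by omega) (by omega)
    obtain ⟨j, rfl⟩ := exists_entry (π := π) (a := c) (by omega) (by omega)
    obtain ⟨l, rfl⟩ := exists_entry (π := π) (a := y) (by omega) (by omega)
    simp only [time_entry] at h5 ⊢
    by_contra hc
    have hne : l ≠ i := by rintro rfl; omega
    have hne' : l.val ≠ i.val := fun h => hne (Fin.ext h)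
    refine h l i j (by rw [Fin.lt_def]; omega) (by rw [Fin.lt_def]; omega) ?_
    simp only [Fin.lt_def]
    omega
  · intro h i j l h1 h2 ⟨h3, h4⟩
    simp only [Fin.lt_def] at h1 h2 h3 h4
    have := h ((π j).val + 1) ((π l).val + 1) ((π i).val + 1)
    simp only [time_entry] at this
    omega

theorem isRegionOrder_time (h : Avoids312 π) : IsRegionOrder n n (time π) where
  top _ ha := time_outer ha
  lt _ h1 h2 := time_lt h1 h2
  avoid := avoids312_iff.1 h
  surj r hr := ⟨(π ⟨r, hr⟩).val + 1, by omega, (π ⟨r, hr⟩).2, by rw [time_entry]⟩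

theorem clipVertex_eq (π : Equiv.Perm (Fin n)) (i : Fin n) :
    clipVertex π i = vtx n ((π i).val + 1) := by
  have := (π i).2
  ext
  rw [vtx_val (by omega) (by omega)]
  simp [clipVertex]

theorem mem_remainingVertices {a : ℕ} (ha : a ≤ n + 1) (i : Fin n) :
    vtx n a ∈ remainingVertices π i ↔ i.val ≤ time π a := by
  simp only [remainingVertices, Finset.mem_filter, Finset.mem_univ, true_and, clipVertex_eq]
  constructor
  · intro h
    by_contra hc
    have ht : time π a < n := by omega
    exact h ⟨time π a, ht⟩ (by rw [Fin.lt_def]; simp; omega) (by rw [entry_time])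
  · intro h j hj he
    have := (π j).2
    have := vtx_inj ha (by omega) he
    rw [this, time_entry] at h
    rw [Fin.lt_def] at hj
    omega

/-- Consecutive vertices and the root side are visible pairs too, so adding the sides removes the
exceptions of `mem_chordsOf`. -/
theorem adj_iff {M k : ℕ} {q : ℕ → ℕ} (h : IsRegionOrder M k q) {a b : ℕ}
    (hab : a < b) (hb : b ≤ M + 1) :
    s(vtx M a, vtx M b) ∈ polygonSides (M + 2) ∪ chordsOf M q ↔ Vis q a b := by
  rw [Finset.mem_union, mem_sides hab hb, mem_chordsOf hab hb]
  constructor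
  · rintro ((rfl | ⟨rfl, rfl⟩) | h)
    · exact ⟨hab, fun c _ _ => by omega⟩
    · refine ⟨hab, fun c h3 h4 => ?_⟩
      have := h.lt c (by omega) (by omega)
      rw [h.top 0 (by omega), h.top (M + 1) (by omega)]
      exact ⟨this, this⟩
    · exact h.2.2
  · intro h
    tauto

theorem not_mem_sides_self {M : ℕ} (v : Fin (M + 2)) : s(v, v) ∉ polygonSides (M + 2) := by
  simp only [polygonSides, Finset.mem_image, Finset.mem_univ, true_and, not_exists]
  intro i hi
  obtain ⟨h1, h2⟩ : i = v ∧ finRotate (M + 2) i = v := by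
    rcases Sym2.eq_iff.1 hi with h | h <;> exact h
  obtain ⟨a, ha, rfl⟩ := exists_vtx i
  rcases Nat.lt_or_ge a (M + 1) with h | h
  · rw [finRotate_vtx (by omega), ← h1] at h2
    have := vtx_inj (by omega) (by omega) h2
    omega
  · obtain rfl : a = M + 1 := by omega
    rw [finRotate_vtx_last, ← h1] at h2
    have := vtx_inj (by omega) (by omega) h2
    omega

theorem mem_neighboursIn {M k : ℕ} {q : ℕ → ℕ} (h : IsRegionOrder M k q)
    {S : Finset (Fin (M + 2))} {a b : ℕ} (ha : a ≤ M + 1) (hb : b ≤ M + 1) :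
    vtx M b ∈ neighboursIn (chordsOf M q) S (vtx M a) ↔
      vtx M b ∈ S ∧ (Vis q a b ∨ Vis q b a) := by
  rw [neighboursIn, Finset.mem_filter]
  refine and_congr_right fun _ => ?_
  rcases lt_trichotomy a b with hab | rfl | hab
  · rw [adj_iff h hab hb]
    exact ⟨Or.inl, fun h => h.resolve_right fun h => by have := h.1; omega⟩
  · refine ⟨fun hm => ?_, fun hv => by rcases hv with hv | hv <;> exact absurd hv.1 (lt_irrefl _)⟩
    rcases Finset.mem_union.1 hm with hm | hm
    · exact absurd hm (not_mem_sides_self _)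
    · exact absurd (isDiagonal_of_mem_chordsOf hm).1 (by simp)
  · rw [Sym2.eq_swap, adj_iff h hab ha]
    exact ⟨Or.inr, fun h => h.resolve_left fun h => by have := h.1; omega⟩

/-- The remaining neighbours of a vertex when it is deleted. -/
theorem neighboursIn_entry (h : Avoids312 π) (i : Fin n) : ∃ l r, l < (π i).val + 1 ∧
    (π i).val + 1 < r ∧ r ≤ n + 1 ∧
    neighboursIn (chordsOf n (time π)) (remainingVertices π i) (clipVertex π i) =
      {vtx n l, vtx n r} := by
  have hv := (π i).2
  -- The neighbours are the nearest later-deleted vertices on either side.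
  obtain ⟨l, -, hl, hl', hl''⟩ := exists_last_before (P := fun a => i.val < time π a)
    (x := (π i).val + 1) (a := 0) (by simp [time_outer]) (by omega)
  obtain ⟨r, hr, hrn, hr', hr''⟩ := exists_first_after (P := fun a => i.val < time π a)
    (x := (π i).val + 1) (b := n + 1) (by simp [time_outer]) (by omega)
  simp only [not_lt] at hl'' hr''
  refine ⟨l, r, hl, hr, hrn, ?_⟩
  have hlt : ∀ c, time π c ≤ i → c ≠ (π i).val + 1 → time π c < i := fun c h1 h2 => by
    rcases eq_or_lt_of_le h1 with h3 | h3
    · exact absurd (time_inj (π := π) (b := (π i).val + 1) (by rw [h3, time_entry]) (by omega)) h2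
    · exact h3
  ext w
  obtain ⟨b, hb, rfl⟩ := exists_vtx w
  rw [clipVertex_eq, mem_neighboursIn (isRegionOrder_time h) (by omega) hb,
    mem_remainingVertices hb]
  simp only [Finset.mem_insert, Finset.mem_singleton]
  constructor
  · rintro ⟨h1, h2 | h2⟩
    · right
      have h3 := h2.1
      have hbr : ¬ r < b := fun h => by
        have := (h2.2 r hr h).1
        rw [time_entry] at this; omega
      have hrb : ¬ b < r := fun h => by
        have := hlt b (hr'' b h3 h) (by omega)
        omega
      rw [show b = r by omega]
    · left
      have h3 := h2.1
      have hbr : ¬ b < l := fun h => by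
        have := (h2.2 l h hl).2
        rw [time_entry] at this; omega
      have hrb : ¬ l < b := fun h => by
        have := hlt b (hl'' b h h3) (by omega)
        omega
      rw [show b = l by omega]
  · rintro (h1 | h1)
    · obtain rfl := vtx_inj hb (by omega) h1
      refine ⟨by omega, Or.inr ⟨hl, fun c h2 h3 => ?_⟩⟩
      have := hlt c (hl'' c h2 h3) (by omega)
      rw [time_entry]
      omega
    · obtain rfl := vtx_inj hb (by omega) h1
      refine ⟨by omega, Or.inl ⟨hr, fun c h2 h3 => ?_⟩⟩
      have := hlt c (hr'' c h2 h3) (by omega)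
      rw [time_entry]
      omega

/-- A remaining vertex `u` with a smaller label than the clipped `v` has three neighbours: the
nearest remaining vertices `l` and `x` on its two sides, and the first vertex `y` after `x` that
outlives `x`. It is 312-avoidance that makes `x` go before `u`, so that `u` sees past it. -/
theorem isClipSequence_chordsOf (h : Avoids312 π) :
    IsClipSequence (chordsOf n (time π)) π := by
  intro i
  have hv := (π i).2
  have H := isRegionOrder_time h
  refine ⟨⟨?_, ?_⟩, ?_⟩
  · rw [clipVertex_eq, mem_remainingVertices (by omega), time_entry]
  · obtain ⟨l, r, h1, h2, h3, h4⟩ := neighboursIn_entry h i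
    rw [h4, Finset.card_pair]
    intro he
    have := vtx_inj (by omega) (by omega) he
    omega
  · rintro w ⟨hw, hcard⟩
    obtain ⟨u, hu, rfl⟩ := exists_vtx w
    rw [mem_remainingVertices hu] at hw
    by_contra hlt
    rw [clipVertex_eq, Fin.le_def, vtx_val (by omega) (by omega)] at hlt
    -- Coordinate `0` carries the largest label.
    have hu0 : u ≠ 0 := by rintro rfl; rw [vtx_zero_val] at hlt; omega
    rw [vtx_val (by omega) hu] at hlt
    set v := (π i).val + 1 with hvdef
    have htv : time π v = i := time_entry π i
    have huv : u < v := by omega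
    have htu : i.val < time π u := by
      rcases eq_or_lt_of_le hw with h1 | h1
      · have := time_inj (π := π) (a := v) (b := u) (by omega) (by omega)
        omega
      · exact h1
    obtain ⟨l, -, hl, hl', hl''⟩ := exists_last_before (P := fun a => i.val ≤ time π a)
      (x := u) (a := 0) (by simp [time_outer, i.2.le]) (by omega)
    obtain ⟨x, hx, hxv, hx', hx''⟩ := exists_first_after (P := fun a => i.val ≤ time π a)
      (x := u) (b := v) (by omega) huv
    simp only [not_le] at hl'' hx''
    have hxu : time π x < time π u := by
      by_contra hc
      have hxv' : x < v := by
        rcases eq_or_lt_of_le hxv with rfl | h1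
        · omega
        · exact h1
      have := H.avoid u x v (by omega) hx hxv' (by omega) (by omega)
      have := time_inj (π := π) (a := u) (b := x) (by omega) (H.lt u (by omega) (by omega))
      omega
    have hxn : time π x < n := H.lt x (by omega) (by omega)
    obtain ⟨y, hy, hyn, hy', hy''⟩ := exists_first_after (P := fun a => time π x < time π a)
      (x := x) (b := n + 1) (by simpa [time_outer] using hxn) (by omega)
    simp only [not_lt] at hy''
    have hsub : ({vtx n l, vtx n x, vtx n y} : Finset (Fin (n + 2))) ⊆
        neighboursIn (chordsOf n (time π)) (remainingVertices π i) (vtx n u) := by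
      intro w hw
      simp only [Finset.mem_insert, Finset.mem_singleton] at hw
      rcases hw with rfl | rfl | rfl
      · rw [mem_neighboursIn H (by omega) (by omega), mem_remainingVertices (by omega)]
        refine ⟨hl', Or.inr ⟨hl, fun c h1 h2 => ?_⟩⟩
        have := hl'' c h1 h2
        omega
      · rw [mem_neighboursIn H (by omega) (by omega), mem_remainingVertices (by omega)]
        refine ⟨hx', Or.inl ⟨hx, fun c h1 h2 => ?_⟩⟩
        have := hx'' c h1 h2
        omega
      · rw [mem_neighboursIn H (by omega) (by omega), mem_remainingVertices (by omega)]
        refine ⟨by omega, Or.inl ⟨by omega, fun c h1 h2 => ?_⟩⟩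
        rcases lt_trichotomy c x with h3 | rfl | h3
        · have := hx'' c h1 h3
          omega
        · exact ⟨hxu, hy'⟩
        · have := hy'' c h3 h2
          omega
    have h3 : ({vtx n l, vtx n x, vtx n y} : Finset (Fin (n + 2))).card = 3 := by
      refine Finset.card_eq_three.2 ⟨_, _, _, ?_, ?_, ?_, rfl⟩ <;> intro he <;>
        have := vtx_inj (by omega) (by omega) he <;> omega
    have := Finset.card_le_card hsub
    omega

theorem clipSequence_unique {T : Finset (Sym2 (Fin (n + 2)))} {π' : Equiv.Perm (Fin n)}
    (h : IsClipSequence T π) (h' : IsClipSequence T π') : π = π' := by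
  have key : ∀ m : ℕ, ∀ i : Fin n, i.val = m → π i = π' i := by
    intro m
    induction m using Nat.strong_induction_on with
    | _ m ih =>
      rintro i rfl
      have hr : remainingVertices π i = remainingVertices π' i := by
        unfold remainingVertices
        refine Finset.filter_congr fun v _ => forall_congr' fun j => forall_congr' fun hj => ?_
        rw [clipVertex, clipVertex, ih j.val hj j rfl]
      have h1 := h i
      rw [hr] at h1
      exact Fin.castAdd_injective n 2 (h1.unique (h' i))
  exact Equiv.ext fun i => key _ i rfl

/-- Every triangulation comes from a 312-avoiding permutation. -/
theorem exists_perm_of_triangulation (hn : 1 ≤ n) {T : Finset (Sym2 (Fin (n + 2)))}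
    (hT : T ∈ triangulations (n + 2)) :
    ∃ π : Equiv.Perm (Fin n), Avoids312 π ∧ T = chordsOf n (time π) := by
  obtain ⟨q, hq, he⟩ := exists_isRegionOrder hn hT.1
  have hc : T.card + 1 = n := by have := hT.2; omega
  rw [hc] at hq
  -- With as many regions as inner vertices, the ranks are a bijection; its inverse is the
  -- permutation.
  let f : Fin n → Fin n := fun v => ⟨q (v.val + 1), hq.lt _ (by omega) (by omega)⟩
  have hf : Function.Bijective f := by
    refine (Finite.surjective_iff_bijective).1 fun r => ?_
    obtain ⟨a, h1, h2, h3⟩ := hq.surj r r.2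
    exact ⟨⟨a - 1, by omega⟩, by ext; simp only [f]; rw [← h3]; congr 1; omega⟩
  have ht : time (Equiv.ofBijective f hf).symm = q := by
    funext a
    by_cases ha : 1 ≤ a ∧ a ≤ n
    · rw [time, dif_pos ha]
      simp only [Equiv.symm_symm, Equiv.ofBijective_apply, f]
      congr 1; omega
    · rw [time, dif_neg ha, hq.top a (by omega)]
  exact ⟨_, avoids312_iff.2 (by rw [ht]; exact hq.avoid), by rw [ht, he]⟩

theorem chordsOf_mem_triangulations (hn : 1 ≤ n) (h : Avoids312 π) :
    chordsOf n (time π) ∈ triangulations (n + 2) := by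
  have := (isRegionOrder_time h).card_chordsOf hn
  exact ⟨isDissection_chordsOf _ _, by omega⟩

/-- `T` comes from some permutation, which is a clip sequence of `T`; uniqueness of clip sequences
identifies it with `π`. -/
theorem eq_chordsOf_of_isClipSequence (hn : 1 ≤ n) {T : Finset (Sym2 (Fin (n + 2)))}
    (hT : T ∈ triangulations (n + 2)) (hc : IsClipSequence T π) :
    T = chordsOf n (time π) := by
  obtain ⟨π', h1, rfl⟩ := exists_perm_of_triangulation hn hT
  rw [clipSequence_unique hc (isClipSequence_chordsOf h1)]

end Clip

/-! ### Block words as words without adjacent or extremal `U`. -/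

section Patterns

/-- The words `D^{i_1} U D^{i_2} U ⋯ U D^{i_k}` with `i_1, …, i_k ≥ 1`, letter by letter. -/
inductive IsBlockWord : ℕ → List UpDown → Prop
  | single : IsBlockWord 1 [UpDown.D]
  | extend {k : ℕ} {L : List UpDown} : IsBlockWord k L → IsBlockWord k (UpDown.D :: L)
  | block {k : ℕ} {L : List UpDown} : IsBlockWord k L →
      IsBlockWord (k + 1) (UpDown.D :: UpDown.U :: L)

theorem descentBlocks_singleton (i : ℕ) :
    descentBlocks [i] = List.replicate i UpDown.D := by
  simp [descentBlocks, List.intercalate]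

theorem descentBlocks_cons (i j : ℕ) (I : List ℕ) :
    descentBlocks (i :: j :: I) =
      List.replicate i UpDown.D ++ UpDown.U :: descentBlocks (j :: I) := by
  simp [descentBlocks, List.intercalate]

theorem isBlockWord_descentBlocks : ∀ I : List ℕ, I ≠ [] → (∀ i ∈ I, 1 ≤ i) →
    IsBlockWord I.length (descentBlocks I)
  | [], h, _ => absurd rfl h
  | [i], _, h => by
    rw [descentBlocks_singleton]
    have : 1 ≤ i := h i (by simp)
    induction i, this using Nat.le_induction with
    | base => exact .single
    | succ m hm ih => exact .extend (ih (by simp) (by simpa using hm))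
  | i :: j :: I, _, h => by
    rw [descentBlocks_cons]
    have ih := isBlockWord_descentBlocks (j :: I) (by simp) fun x hx => h x (by simp_all)
    have : 1 ≤ i := h i (by simp)
    clear h
    induction i, this using Nat.le_induction with
    | base => exact .block ih
    | succ m hm ih' => exact .extend (ih' (by simp))

theorem isBlockWord_iff (k : ℕ) (hk : 1 ≤ k) (L : List UpDown) :
    (∃ I : List ℕ, I.length = k ∧ (∀ i ∈ I, 1 ≤ i) ∧ L = descentBlocks I) ↔ IsBlockWord k L := by
  constructor
  · rintro ⟨I, rfl, h, rfl⟩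
    exact isBlockWord_descentBlocks I (by rintro rfl; simp at hk) h
  · intro h
    clear hk
    induction h with
    | single => exact ⟨[1], rfl, by simp, by simp [descentBlocks_singleton]⟩
    | @extend k L hL ih =>
      obtain ⟨I, rfl, h, rfl⟩ := ih
      match I, hL, h with
      | [], hL, _ => exact absurd hL (by simp only [List.length_nil]; rintro ⟨⟩)
      | [i], _, h =>
        refine ⟨[i + 1], rfl, by simp, ?_⟩
        rw [descentBlocks_singleton, descentBlocks_singleton, List.replicate_succ]
      | i :: j :: I, _, h =>
        refine ⟨(i + 1) :: j :: I, rfl, fun x hx => ?_, ?_⟩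
        · rcases List.mem_cons.1 hx with rfl | hx
          · omega
          · exact h x (List.mem_cons_of_mem _ hx)
        · rw [descentBlocks_cons, descentBlocks_cons, List.replicate_succ]; rfl
    | @block k L hL ih =>
      obtain ⟨I, rfl, h, rfl⟩ := ih
      match I, hL, h with
      | [], hL, _ => exact absurd hL (by simp only [List.length_nil]; rintro ⟨⟩)
      | i :: I, _, h =>
        refine ⟨1 :: i :: I, rfl, fun x hx => ?_, by rw [descentBlocks_cons]; rfl⟩
        rcases List.mem_cons.1 hx with rfl | hx
        · omega
        · exact h x hx

/-- The letter at `j` is `U`, or the word has ended. -/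
def NotDown (L : List UpDown) (j : ℕ) : Prop := L[j]? ≠ some UpDown.D

open Classical in
-- Treating the end of the word as one more separator makes the count the number of blocks and lets
-- the last condition also exclude a final `U`.
theorem isBlockWord_iff_count (L : List UpDown) : ∀ k, IsBlockWord k L ↔
    Nat.count (NotDown L) (L.length + 1) = k ∧ ¬ NotDown L 0 ∧
      ∀ j, j < L.length → NotDown L j → ¬ NotDown L (j + 1) := by
  have hD : ∀ L, ¬ NotDown (UpDown.D :: L) 0 := fun L => by simp [NotDown]
  have hU : ∀ L, NotDown (UpDown.U :: L) 0 := fun L => by simp [NotDown]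
  have hnil : ∀ j, NotDown [] j := fun j => by simp [NotDown]
  have hcD : ∀ L m, Nat.count (NotDown (UpDown.D :: L)) (m + 1) = Nat.count (NotDown L) m :=
    fun L m => by
      rw [Nat.count_succ', if_neg (hD L)]
      congr 1
  have hcU : ∀ L m, Nat.count (NotDown (UpDown.U :: L)) (m + 1) =
      Nat.count (NotDown L) m + 1 := fun L m => by
      rw [Nat.count_succ', if_pos (hU L)]
      congr 2
  have hs : ∀ x L j, NotDown (x :: L) (j + 1) ↔ NotDown L j := fun x L j => by simp [NotDown]
  intro k
  constructor
  · intro h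
    induction h with
    | single =>
      refine ⟨?_, hD _, fun j hj => ?_⟩
      · rw [List.length_singleton, hcD, Nat.count_succ, if_pos (hnil 0), Nat.count_zero]
      · simp only [List.length_singleton, Nat.lt_one_iff] at hj
        subst hj
        exact fun h => absurd h (hD _)
    | @extend k L hL ih =>
      refine ⟨by rw [List.length_cons, hcD, ih.1], hD _, fun j hj => ?_⟩
      rcases j with - | j
      · exact fun h => absurd h (hD _)
      · rw [hs, hs]
        exact ih.2.2 j (by simpa using hj)
    | @block k L hL ih =>
      refine ⟨by rw [List.length_cons, List.length_cons, hcD, hcU, ih.1], hD _, fun j hj => ?_⟩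
      rcases j with - | - | j
      · exact fun h => absurd h (hD _)
      · intro _
        rw [hs, hs]
        exact ih.2.1
      · rw [hs, hs, hs, hs]
        exact ih.2.2 j (by simpa using hj)
  · induction hlen : L.length using Nat.strong_induction_on generalizing L k with
    | _ m ih =>
      rintro ⟨h1, h2, h3⟩
      subst hlen
      match L with
      | [] => exact absurd (hnil 0) h2
      | UpDown.U :: L => exact absurd (hU L) h2
      | [UpDown.D] =>
        rw [List.length_singleton, hcD, Nat.count_succ, if_pos (hnil 0), Nat.count_zero] at h1
        subst h1
        exact .single
      | UpDown.D :: UpDown.D :: L =>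
        rw [List.length_cons, hcD] at h1
        refine .extend (ih (L.length + 1) (by simp) (UpDown.D :: L) k rfl
          ⟨h1, hD _, fun j hj => ?_⟩)
        have := h3 (j + 1) (by simpa using hj)
        rwa [hs, hs] at this
      | UpDown.D :: UpDown.U :: L =>
        rw [List.length_cons, List.length_cons, hcD, hcU] at h1
        subst h1
        refine .block (ih L.length (by simp) L _ rfl ⟨rfl, ?_, fun j hj => ?_⟩)
        · have := h3 1 (by simp)
          rw [hs, hs] at this
          exact this (hU L)
        · have := h3 (j + 2) (by simpa using hj)
          rwa [hs, hs, hs, hs] at this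

end Patterns

/-! ### Decreasing runs and the vertices that do not start one. -/

section Runs

variable {n : ℕ} {π : Equiv.Perm (Fin n)}

/-- A maximal decreasing run of `π` ends at position `j`. -/
def Asc (π : Equiv.Perm (Fin n)) (j : ℕ) : Prop :=
  ∀ h : j + 1 < n, π ⟨j, by omega⟩ < π ⟨j + 1, h⟩

noncomputable instance : DecidablePred (Asc π) := fun _ => Classical.dec _

/-- `π` has `k` maximal decreasing runs, all of length at least two. -/
structure HasLongRuns (π : Equiv.Perm (Fin n)) (k : ℕ) : Prop where
  count : Nat.count (Asc π) n = k
  zero : ¬ Asc π 0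
  succ : ∀ j, j + 1 < n → Asc π j → ¬ Asc π (j + 1)

theorem asc_iff_notDown {j : ℕ} (hj : j < n) : Asc π j ↔ NotDown (upDownPattern π) j := by
  unfold Asc NotDown upDownPattern
  rcases Nat.lt_or_ge (j + 1) n with h | h
  · have hl : (List.zipWith (fun a b => if b < a then UpDown.D else UpDown.U)
        (List.ofFn π) (List.ofFn π).tail)[j]? =
        some (if π ⟨j + 1, h⟩ < π ⟨j, hj⟩ then UpDown.D else UpDown.U) := by
      rw [List.getElem?_eq_getElem (by simp; omega)]
      simp
    rw [hl]
    have hne : π ⟨j, hj⟩ ≠ π ⟨j + 1, h⟩ := fun he => by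
      have := π.injective he
      simp at this
    constructor
    · intro h'
      have h1 := h' h
      rw [if_neg (not_lt.2 h1.le)]
      simp
    · intro h' _
      by_contra hc
      exact h' (by rw [if_pos (lt_of_le_of_ne (not_lt.1 hc) hne.symm)])
  · rw [List.getElem?_eq_none (by simp; omega)]
    simp
    omega

theorem isDecent_iff {k : ℕ} (hk : 1 ≤ k) (hn : 1 ≤ n) :
    IsDecentWithBlocks k π ↔ HasLongRuns π k := by
  classical
  have hlen : (upDownPattern π).length + 1 = n := by
    simp [upDownPattern]; omega
  rw [IsDecentWithBlocks, isBlockWord_iff k hk, isBlockWord_iff_count, hlen]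
  have hc : Nat.count (NotDown (upDownPattern π)) n = Nat.count (Asc π) n := by
    rw [Nat.count_eq_card_filter_range, Nat.count_eq_card_filter_range]
    congr 1
    refine Finset.filter_congr fun j hj => ?_
    rw [asc_iff_notDown (Finset.mem_range.1 hj)]
  constructor
  · rintro ⟨h1, h2, h3⟩
    refine ⟨by rw [← hc, h1], by rwa [asc_iff_notDown (by omega)], fun j hj => ?_⟩
    rw [asc_iff_notDown (by omega), asc_iff_notDown hj]
    exact h3 j (by omega)
  · rintro ⟨h1, h2, h3⟩
    refine ⟨by rw [hc, h1], by rwa [← asc_iff_notDown (by omega)], fun j hj => ?_⟩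
    rw [← asc_iff_notDown (by omega), ← asc_iff_notDown (by omega)]
    exact h3 j (by omega)

/-- For `A = Asc π` the count before a position is the index of its run, so this tests whether two
positions share a run. -/
theorem count_eq_iff {A : ℕ → Prop} [DecidablePred A] {a b : ℕ} (hab : a ≤ b) :
    Nat.count A a = Nat.count A b ↔ ∀ j, a ≤ j → j < b → ¬ A j := by
  constructor
  · intro h j h1 h2 hj
    have h3 := Nat.count_monotone A h1
    have h4 := Nat.count_monotone A (show j + 1 ≤ b by omega)
    rw [Nat.count_succ, if_pos hj] at h4
    omega
  · intro h
    induction b, hab using Nat.le_induction with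
    | base => rfl
    | succ m hm ih =>
      rw [Nat.count_succ, if_neg (h m hm (by omega)), ih fun j h1 h2 => h j h1 (by omega)]
      rfl

theorem isRunStart_iff (i : Fin n) : IsRunStart π i ↔ i.val = 0 ∨ Asc π (i.val - 1) := by
  rcases Nat.eq_zero_or_pos i.val with h | h
  · exact ⟨fun _ => Or.inl h, fun _ j hj => by omega⟩
  · have h' : i.val - 1 + 1 < n := by omega
    have e : (⟨i.val - 1 + 1, h'⟩ : Fin n) = i := by ext; simp; omega
    constructor
    · intro hs
      refine Or.inr fun _ => ?_
      have := hs ⟨i.val - 1, by omega⟩ (by simp; omega)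
      simp only [e]
      exact this
    · rintro (h0 | ha) j hj
      · omega
      · have := ha h'
        rw [e] at this
        have ej : j = ⟨i.val - 1, by omega⟩ := by ext; simp; omega
        rw [ej]
        exact this

theorem sameRun_iff (i j : Fin n) :
    SameRun π i j ↔ Nat.count (Asc π) i = Nat.count (Asc π) j := by
  have key : ∀ i j : Fin n, i ≤ j →
      (SameRun π i j ↔ Nat.count (Asc π) i = Nat.count (Asc π) j) := by
    intro i j hij
    rw [count_eq_iff hij]
    simp only [SameRun, min_eq_left hij, max_eq_right hij, isRunStart_iff]
    constructor
    · intro h l h1 h2 ha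
      exact h ⟨l + 1, by omega⟩ (by rw [Fin.lt_def]; simp; omega)
        (by rw [Fin.le_def]; simp; omega) (Or.inr ha)
    · intro h l h1 h2 ha
      rw [Fin.lt_def] at h1
      rw [Fin.le_def] at h2
      rcases ha with ha | ha
      · omega
      · exact h _ (by omega) (by omega) ha
  rcases le_total i j with h | h
  · exact key i j h
  · rw [eq_comm, ← key j i h]
    simp only [SameRun, min_comm, max_comm]

theorem run_decreasing {s s' : Fin n} (h : s < s')
    (he : Nat.count (Asc π) s = Nat.count (Asc π) s') : π s' < π s := by
  rw [count_eq_iff (Fin.le_def.1 h.le)] at he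
  have key : ∀ m : ℕ, s.val + 1 ≤ m → ∀ hm : m < n, m ≤ s'.val → π ⟨m, hm⟩ < π s := by
    intro m hm
    induction m, hm using Nat.le_induction with
    | base =>
      intro hm hs
      have := he s.val le_rfl (by omega)
      unfold Asc at this
      push Not at this
      obtain ⟨h1, h2⟩ := this
      refine lt_of_le_of_ne h2 fun e => ?_
      have := π.injective e
      simp [Fin.ext_iff] at this
    | succ m hm ih =>
      intro hm' hs
      have := he m (by omega) (by omega)
      unfold Asc at this
      push Not at this
      obtain ⟨h1, h2⟩ := this
      exact lt_of_le_of_lt h2 (ih (by omega) (by omega))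
  exact key s' (by omega) s'.2 le_rfl

/-- The vertex `a` is not the first entry of a run (for a 312-avoiding permutation). -/
def Kept (π : Equiv.Perm (Fin n)) (a : ℕ) : Prop := time π (a + 1) ≤ time π a

instance : DecidablePred (Kept π) := fun a =>
  inferInstanceAs (Decidable (time π (a + 1) ≤ time π a))

/-- The index of the run that contains `a`. -/
noncomputable def blockIdx (π : Equiv.Perm (Fin n)) (a : ℕ) : ℕ :=
  Nat.count (Asc π) (time π a)

/-- The run indices of the entries that do not start a run, in the order of the entries. -/
noncomputable def regionOrder (π : Equiv.Perm (Fin n)) (x : ℕ) : ℕ :=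
  blockIdx π (Nat.nth (Kept π) x)

theorem kept_outer {a : ℕ} (h : a = 0 ∨ n < a) : Kept π a := by
  rw [Kept, time_outer h]; exact time_le _ _

/-- All indices beyond `n` are kept, so `Nat.nth (Kept π)` enumerates without default values and
`Nat.count (Kept π)` is a left inverse of it. -/
theorem infinite_kept (π : Equiv.Perm (Fin n)) : {a | Kept π a}.Infinite := by
  refine Set.infinite_of_not_bddAbove fun ⟨m, hm⟩ => ?_
  have := hm (show Kept π (m + n + 1) from kept_outer (by omega))
  omega

theorem kept_nth (π : Equiv.Perm (Fin n)) (x : ℕ) : Kept π (Nat.nth (Kept π) x) :=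
  Nat.nth_mem_of_infinite (infinite_kept π) x

theorem count_nth_kept (π : Equiv.Perm (Fin n)) (x : ℕ) :
    Nat.count (Kept π) (Nat.nth (Kept π) x) = x :=
  Nat.count_nth_of_infinite (infinite_kept π) x

theorem nth_kept_strictMono (π : Equiv.Perm (Fin n)) : StrictMono (Nat.nth (Kept π)) :=
  Nat.nth_strictMono (infinite_kept π)

theorem nth_kept_zero (π : Equiv.Perm (Fin n)) : Nat.nth (Kept π) 0 = 0 :=
  Nat.nth_zero_of_zero (kept_outer (Or.inl rfl))

theorem blockIdx_mono {a b : ℕ} (h : time π a ≤ time π b) : blockIdx π a ≤ blockIdx π b :=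
  Nat.count_monotone _ h

theorem run_decreasing' {a b : ℕ} (h : time π a < time π b) (hb : time π b < n)
    (he : blockIdx π a = blockIdx π b) : b < a := by
  have := run_decreasing (π := π) (s := ⟨time π a, by omega⟩) (s' := ⟨time π b, hb⟩) h he
  have h1 := entry_time (π := π) (a := a) (by omega)
  have h2 := entry_time hb
  rw [Fin.lt_def] at this
  omega

theorem not_kept_inner {a : ℕ} (h : ¬ Kept π a) : 1 ≤ a ∧ a ≤ n := by
  by_contra hc
  exact h (kept_outer (by omega))

/-- Let `w` precede the entry `v` in the word. If `w < v` and `v + 1` came earlier, then `v + 1, w,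
v` would be a 312; if `w > v` and `v + 1` came later, then `w, v, v + 1` would be one. -/
theorem kept_iff (h : Avoids312 π) (i : Fin n) :
    Kept π ((π i).val + 1) ↔ ¬ IsRunStart π i := by
  have H := isRegionOrder_time h
  have hv := (π i).2
  rw [Kept, time_entry, isRunStart_iff]
  constructor
  · rintro h1 (h2 | h2)
    · have := time_inj (π := π) (a := (π i).val + 1 + 1) (b := (π i).val + 1)
        (by rw [time_entry]; omega) (by omega)
      omega
    · have hne : time π ((π i).val + 1 + 1) ≠ i.val := fun he => by
        have := time_inj (π := π) (a := (π i).val + 1 + 1) (b := (π i).val + 1)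
          (by rw [time_entry]; omega) (by omega)
        omega
      have hlt : i.val - 1 + 1 < n := by omega
      have h3 := h2 hlt
      have e : (⟨i.val - 1 + 1, hlt⟩ : Fin n) = i := by ext; simp; omega
      rw [e, Fin.lt_def] at h3
      have h4 := time_entry π ⟨i.val - 1, by omega⟩
      simp only at h4
      set w := (π ⟨i.val - 1, by omega⟩).val + 1 with hw
      have h5 := time_entry π i
      have h6 := inner_of_time_lt (π := π) (a := (π i).val + 1 + 1) (by omega)
      have h7 := H.avoid w ((π i).val + 1) ((π i).val + 1 + 1) (by omega) (by omega) (by omega)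
        h6.2
      omega
  · intro h1
    push Not at h1
    obtain ⟨h2, h3⟩ := h1
    by_contra hc
    unfold Asc at h3
    push Not at h3
    obtain ⟨h4, h5⟩ := h3
    have e : (⟨i.val - 1 + 1, h4⟩ : Fin n) = i := by ext; simp; omega
    rw [e, Fin.le_def] at h5
    have h6 := time_entry π ⟨i.val - 1, by omega⟩
    simp only at h6
    set w := (π ⟨i.val - 1, by omega⟩).val + 1 with hw
    have h7 := time_entry π i
    have hne : w ≠ (π i).val + 1 := fun he => by rw [he] at h6; omega
    have hne' : w ≠ (π i).val + 1 + 1 := fun he => by rw [he] at h6; omega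
    have h8 := H.avoid ((π i).val + 1) ((π i).val + 1 + 1) w (by omega) (by omega) (by omega)
      (by omega)
    omega

theorem not_kept_iff (h : Avoids312 π) {a : ℕ} (ha : time π a < n) :
    ¬ Kept π a ↔ time π a = 0 ∨ Asc π (time π a - 1) := by
  have h1 := kept_iff h ⟨time π a, ha⟩
  rw [entry_time ha, isRunStart_iff] at h1
  tauto

/-- The first entry of a run exceeds all earlier entries. -/
theorem lt_of_not_kept (h : Avoids312 π) {v w : ℕ} (hv : ¬ Kept π v) (hw : 1 ≤ w)
    (ht : time π w < time π v) : w < v := by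
  have H := isRegionOrder_time h
  have hvn := not_kept_inner hv
  rw [Kept, not_le] at hv
  by_contra hc
  have h1 := inner_of_time_lt (π := π) (a := w) (by have := time_le π v; omega)
  have hne : w ≠ v := by rintro rfl; omega
  have hne' : w ≠ v + 1 := by rintro rfl; omega
  have := H.avoid v (v + 1) w hvn.1 (by omega) (by omega) h1.2
  omega

/-- The first entry of a run is deleted before the other ones. -/
theorem time_le_of_not_kept (h : Avoids312 π) {v w : ℕ} (hv : ¬ Kept π v)
    (he : blockIdx π v = blockIdx π w) : time π v ≤ time π w := by
  by_contra hc
  have hvn := not_kept_inner hv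
  rw [not_kept_iff h (time_lt hvn.1 hvn.2)] at hv
  have := (count_eq_iff (A := Asc π) (not_le.1 hc).le).1 he.symm (time π v - 1) (by omega)
    (by omega)
  rcases hv with hv | hv
  · omega
  · exact this hv

end Runs

/-! ### The region order of a permutation with long runs. -/

namespace HasLongRuns

variable {n k : ℕ} {π : Equiv.Perm (Fin n)}

theorem not_asc_of_not_kept (hd : HasLongRuns π k) (h : Avoids312 π) {a : ℕ}
    (ha : ¬ Kept π a) : ¬ Asc π (time π a) := by
  have hn := not_kept_inner ha
  have ht := time_lt (π := π) hn.1 hn.2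
  rw [not_kept_iff h ht] at ha
  by_cases h0 : time π a = 0
  · rw [h0]; exact hd.zero
  · have := hd.succ (time π a - 1) (by omega) (ha.resolve_left h0)
    rwa [Nat.sub_add_cancel (by omega)] at this

/-- The second entry of a run is the parent of the first one. -/
theorem exists_parent (hd : HasLongRuns π k) (h : Avoids312 π) {a : ℕ} (ha : ¬ Kept π a) :
    ∃ v, 1 ≤ v ∧ v < a ∧ time π v = time π a + 1 ∧ Kept π v ∧
      (∀ c, v < c → c < a → time π c < time π a) ∧ blockIdx π v = blockIdx π a := by
  have hn := not_kept_inner ha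
  have ht := time_lt (π := π) hn.1 hn.2
  have hasc := hd.not_asc_of_not_kept h ha
  have hasc' := hasc
  unfold Asc at hasc
  push Not at hasc
  obtain ⟨h1, h2⟩ := hasc
  have h3 := time_entry π ⟨time π a + 1, h1⟩
  have h4 := entry_time ht
  have h5 : π ⟨time π a + 1, h1⟩ ≠ π ⟨time π a, ht⟩ := fun he => by
    have := π.injective he
    simp at this
  have h5' : (π ⟨time π a + 1, h1⟩).val ≠ (π ⟨time π a, ht⟩).val := fun he => h5 (Fin.ext he)
  rw [Fin.le_def] at h2
  simp only at h3
  set v := (π ⟨time π a + 1, h1⟩).val + 1 with hv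
  refine ⟨v, by omega, by omega, h3, ?_, fun c hc1 hc2 => ?_, ?_⟩
  · by_contra hk
    rw [not_kept_iff h (by omega), h3] at hk
    rcases hk with hk | hk
    · omega
    · exact hasc' hk
  · have := (isRegionOrder_time h).avoid v c a (by omega) hc1 hc2 hn.2 (by omega)
    have hne : time π c ≠ time π v := fun he => by
      have := time_inj he (by omega)
      omega
    have hne' : time π c ≠ time π a := fun he => by
      have := time_inj he (by omega)
      omega
    omega
  · rw [blockIdx, blockIdx, h3, Nat.count_succ, if_neg hasc']; rfl

theorem pos (hd : HasLongRuns π k) : 2 ≤ n := by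
  by_contra hc
  exact hd.zero fun h => by omega

theorem count_lt (hd : HasLongRuns π k) {j : ℕ} (hj : j < n) : Nat.count (Asc π) j < k := by
  have h1 := Nat.count_monotone (Asc π) (show j ≤ n - 1 by omega)
  have h2 : Nat.count (Asc π) (n - 1 + 1) = Nat.count (Asc π) (n - 1) + 1 := by
    rw [Nat.count_succ, if_pos]
    intro h; omega
  rw [Nat.sub_add_cancel (by omega), hd.count] at h2
  omega

theorem blockIdx_outer (hd : HasLongRuns π k) {a : ℕ} (ha : a = 0 ∨ n < a) :
    blockIdx π a = k := by
  rw [blockIdx, time_outer ha, hd.count]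

theorem blockIdx_lt_iff (hd : HasLongRuns π k) {a : ℕ} : blockIdx π a < k ↔ 1 ≤ a ∧ a ≤ n := by
  constructor
  · intro h
    by_contra hc
    rw [hd.blockIdx_outer (by omega)] at h
    omega
  · intro h
    exact hd.count_lt (time_lt h.1 h.2)

theorem count_kept (hd : HasLongRuns π k) (h : Avoids312 π) :
    Nat.count (Kept π) (n + 1) + k = n + 1 := by
  have hn := hd.pos
  have key : Nat.count (fun a => ¬ Kept π a) (n + 1) = k := by
    rw [← hd.count, Nat.count_eq_card_filter_range, Nat.count_eq_card_filter_range]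
    -- Match each run start with the end of the preceding run, cyclically: the first run start goes
    -- to the last position.
    refine Finset.card_bij' (fun a _ => if time π a = 0 then n - 1 else time π a - 1)
      (fun j _ => if hj : j + 1 < n then (π ⟨j + 1, hj⟩).val + 1
        else (π ⟨0, by omega⟩).val + 1) ?_ ?_ ?_ ?_
    · intro a ha
      simp only [Finset.mem_filter, Finset.mem_range] at ha ⊢
      have h1 := not_kept_inner ha.2
      have h2 := time_lt (π := π) h1.1 h1.2
      have h3 := (not_kept_iff h h2).1 ha.2
      split_ifs with h0
      · exact ⟨by omega, fun h => by omega⟩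
      · exact ⟨by omega, h3.resolve_left h0⟩
    · intro j hj
      simp only [Finset.mem_filter, Finset.mem_range] at hj ⊢
      split_ifs with h0
      · refine ⟨by omega, ?_⟩
        rw [not_kept_iff h (by rw [time_entry]; exact h0), time_entry]
        exact Or.inr hj.2
      · refine ⟨by omega, ?_⟩
        rw [not_kept_iff h (by rw [time_entry]; simp; omega), time_entry]
        exact Or.inl rfl
    · intro a ha
      simp only [Finset.mem_filter, Finset.mem_range] at ha
      have h1 := not_kept_inner ha.2
      have h2 := time_lt (π := π) h1.1 h1.2
      have h3 := entry_time h2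
      by_cases h0 : time π a = 0
      · simp only [h0] at h3
        simp only [h0, if_true]
        rw [dif_neg (by omega), h3]
      · simp only [h0]
        have e : time π a - 1 + 1 = time π a := by omega
        simp only [if_false, e]
        rw [dif_pos h2, h3]
    · intro j hj
      simp only [Finset.mem_filter, Finset.mem_range] at hj
      by_cases h0 : j + 1 < n
      · simp only [h0, dif_pos, time_entry]
        simp
      · simp only [h0, dif_neg, not_false_eq_true, time_entry]
        simp; omega
  have := Finset.card_filter_add_card_filter_not (s := Finset.range (n + 1)) (Kept π)
  rw [← Nat.count_eq_card_filter_range, ← Nat.count_eq_card_filter_range, key,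
    Finset.card_range] at this
  exact this

theorem nth_kept_last (hd : HasLongRuns π k) (h : Avoids312 π) :
    Nat.nth (Kept π) (n - k + 1) = n + 1 := by
  have h1 := hd.count_kept h
  have h2 := Nat.nth_count (p := Kept π) (n := n + 1) (kept_outer (by omega))
  have h4 : Nat.count (Kept π) 1 ≤ Nat.count (Kept π) (n + 1) :=
    Nat.count_monotone _ (by omega)
  have h5 : Nat.count (Kept π) 1 = 1 := by
    rw [Nat.count_succ, if_pos (kept_outer (Or.inl rfl)), Nat.count_zero]
  rwa [show Nat.count (Kept π) (n + 1) = n - k + 1 by omega] at h2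

theorem nth_kept_inner (hd : HasLongRuns π k) (h : Avoids312 π) {x : ℕ} (h1 : 1 ≤ x)
    (h2 : x ≤ n - k) : 1 ≤ Nat.nth (Kept π) x ∧ Nat.nth (Kept π) x ≤ n := by
  have h3 := nth_kept_strictMono π (show 0 < x by omega)
  have h4 := nth_kept_strictMono π (show x < n - k + 1 by omega)
  rw [hd.nth_kept_last h] at h4
  omega

/-- The last entry of run `r` works, since a run of length at least two does not end where it
starts. -/
theorem exists_kept_of_lt (hd : HasLongRuns π k) (h : Avoids312 π) {r : ℕ} (hr : r < k) :
    ∃ a, Kept π a ∧ blockIdx π a = r := by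
  have hc := hd.count
  have hr' : r < Nat.count (Asc π) n := by omega
  have hj : Nat.nth (Asc π) r < n := Nat.nth_lt_of_lt_count hr'
  have hcard : ∀ hf : {j | Asc π j}.Finite, r < hf.toFinset.card := fun hf =>
    lt_of_lt_of_le hr' (Nat.count_le_card hf n)
  have hasc : Asc π (Nat.nth (Asc π) r) := Nat.nth_mem r hcard
  refine ⟨(π ⟨_, hj⟩).val + 1, ?_, ?_⟩
  · by_contra hk
    have := hd.not_asc_of_not_kept h hk
    rw [time_entry] at this
    exact this hasc
  · rw [blockIdx, time_entry]
    exact Nat.count_nth hcard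

/-- A violation of `avoid` for run indices would, by 312-avoidance of `π`, have `x` deleted before
`y` in the same run; but runs decrease and `x < y`. -/
theorem isRegionOrder (hd : HasLongRuns π k) (h : Avoids312 π) :
    IsRegionOrder (n - k) k (regionOrder π) where
  top a ha := by
    refine hd.blockIdx_outer ?_
    rcases ha with rfl | ha
    · exact Or.inl (nth_kept_zero π)
    · have := (nth_kept_strictMono π).monotone (show n - k + 1 ≤ a from ha)
      rw [hd.nth_kept_last h] at this
      exact Or.inr (by omega)
  lt a h1 h2 := hd.blockIdx_lt_iff.2 (hd.nth_kept_inner h h1 h2)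
  avoid x c y h1 h2 h3 h4 h5 := by
    by_contra hc
    have hx := hd.nth_kept_inner h h1 (by omega)
    have hc' := hd.nth_kept_inner h (x := c) (by omega) (by omega)
    have hy := hd.nth_kept_inner h (x := y) (by omega) (by omega)
    have hxc := nth_kept_strictMono π h2
    have hcy := nth_kept_strictMono π h3
    unfold regionOrder at h5 hc
    generalize Nat.nth (Kept π) x = x' at *
    generalize Nat.nth (Kept π) c = c' at *
    generalize Nat.nth (Kept π) y = y' at *
    have h6 : time π x' < time π c' := by
      by_contra h7
      exact hc (blockIdx_mono (not_lt.1 h7))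
    have h7 : time π x' < time π y' := by
      by_contra h7
      have := (isRegionOrder_time h).avoid x' c' y' hx.1 hxc hcy hy.2 (not_lt.1 h7)
      omega
    have := run_decreasing' h7 (time_lt hy.1 hy.2) (le_antisymm (blockIdx_mono h7.le) h5)
    omega
  surj r hr := by
    obtain ⟨a, h1, h2⟩ := hd.exists_kept_of_lt h hr
    have h3 := hd.blockIdx_lt_iff.1 (h2 ▸ hr)
    have h4 := Nat.nth_count h1
    have h5 : Nat.count (Kept π) a ≠ 0 := fun h0 => by
      rw [h0, nth_kept_zero] at h4; omega
    have h6 : ¬ n - k < Nat.count (Kept π) a := fun h0 => by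
      have := (nth_kept_strictMono π).monotone h0
      rw [hd.nth_kept_last h, h4] at this
      omega
    exact ⟨Nat.count (Kept π) a, by omega, by omega, by rw [regionOrder, h4, h2]⟩

end HasLongRuns

/-! ### Removing, merging and closing gaps. -/

section Triangles

variable {n k : ℕ} {π : Equiv.Perm (Fin n)}

/-- `b` is a vertex of the triangle that is cut off together with the vertex `v`. -/
def InTriangle (π : Equiv.Perm (Fin n)) (v b : ℕ) : Prop :=
  b = v ∨ (time π v < time π b ∧ (Vis (time π) v b ∨ Vis (time π) b v))

theorem mem_clipTriangle (h : Avoids312 π) (i : Fin n) {b : ℕ} (hb : b ≤ n + 1) :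
    vtx n b ∈ clipTriangle (chordsOf n (time π)) π i ↔ InTriangle π ((π i).val + 1) b := by
  have hv := (π i).2
  rw [clipTriangle, Finset.mem_insert, clipVertex_eq,
    mem_neighboursIn (isRegionOrder_time h) (by omega) hb, mem_remainingVertices hb, InTriangle,
    time_entry]
  refine or_congr ⟨fun he => vtx_inj hb (by omega) he, fun he => by rw [he]⟩
    (and_congr_left fun hvis => ⟨fun hle => lt_of_le_of_ne hle fun he => ?_, le_of_lt⟩)
  have := time_inj (π := π) (a := b) (b := (π i).val + 1) (by rw [time_entry, he]) (by omega)
  rcases hvis with h1 | h1 <;> have := h1.1 <;> omega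

theorem survives_iff (h : Avoids312 π) {b : ℕ} (hb : b ≤ n + 1) :
    Survives (chordsOf n (time π)) π (vtx n b) ↔
      ∃ v, 1 ≤ v ∧ v ≤ n ∧ Kept π v ∧ InTriangle π v b := by
  constructor
  · rintro ⟨i, h1, h2⟩
    rw [mem_clipTriangle h i hb] at h2
    exact ⟨_, by omega, (π i).2, (kept_iff h i).2 h1, h2⟩
  · rintro ⟨v, h1, h2, h3, h4⟩
    obtain ⟨i, rfl⟩ := exists_entry (π := π) h1 h2
    exact ⟨i, (kept_iff h i).1 h3, (mem_clipTriangle h i hb).2 h4⟩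

theorem isGap_iff (h : Avoids312 π) {a b : ℕ} (ha : a ≤ n + 1) (hb : b ≤ n + 1) :
    IsGap (chordsOf n (time π)) π (vtx n a) (vtx n b) ↔
      Survives (chordsOf n (time π)) π (vtx n a) ∧ Survives (chordsOf n (time π)) π (vtx n b) ∧
      s(vtx n a, vtx n b) ∈ polygonSides (n + 2) ∧
      ∃ v, ¬ Kept π v ∧ InTriangle π v a ∧ InTriangle π v b := by
  rw [IsGap]
  refine and_congr_right fun _ => and_congr_right fun _ => and_congr_right fun _ => ?_
  constructor
  · rintro ⟨i, h1, h2, h3⟩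
    rw [mem_clipTriangle h i ha] at h2
    rw [mem_clipTriangle h i hb] at h3
    exact ⟨_, fun hk => (kept_iff h i).1 hk h1, h2, h3⟩
  · rintro ⟨v, h1, h2, h3⟩
    have hv := not_kept_inner h1
    obtain ⟨i, rfl⟩ := exists_entry (π := π) hv.1 hv.2
    refine ⟨i, by by_contra hc; exact h1 ((kept_iff h i).2 hc), ?_, ?_⟩
    · rwa [mem_clipTriangle h i ha]
    · rwa [mem_clipTriangle h i hb]

theorem isMerged_iff (h : Avoids312 π) {a b : ℕ} (ha : a ≤ n + 1) (hb : b ≤ n + 1) :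
    IsMerged (chordsOf n (time π)) π s(vtx n a, vtx n b) ↔
      ∃ v w, 1 ≤ v ∧ v ≤ n ∧ 1 ≤ w ∧ w ≤ n ∧ v ≠ w ∧ blockIdx π v = blockIdx π w ∧
        Kept π v ∧ Kept π w ∧ InTriangle π v a ∧ InTriangle π v b ∧ InTriangle π w a ∧
        InTriangle π w b := by
  have hS : ∀ S : Finset (Fin (n + 2)), (∀ v ∈ s(vtx n a, vtx n b), v ∈ S) ↔
      vtx n a ∈ S ∧ vtx n b ∈ S := fun S => by simp [Sym2.mem_iff]
  constructor
  · rintro ⟨i, j, h1, h2, h3, h4, h5, h6⟩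
    rw [hS, mem_clipTriangle h i ha, mem_clipTriangle h i hb] at h5
    rw [hS, mem_clipTriangle h j ha, mem_clipTriangle h j hb] at h6
    refine ⟨(π i).val + 1, (π j).val + 1, by omega, (π i).2, by omega, (π j).2, ?_, ?_,
      (kept_iff h i).2 h3, (kept_iff h j).2 h4, h5.1, h5.2, h6.1, h6.2⟩
    · intro he
      exact h1 (π.injective (Fin.ext (by omega)))
    · rw [blockIdx, blockIdx, time_entry, time_entry]
      exact (sameRun_iff i j).1 h2
  · rintro ⟨v, w, h1, h2, h3, h4, h5, h6, h7, h8, h9, h10, h11, h12⟩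
    obtain ⟨i, rfl⟩ := exists_entry (π := π) h1 h2
    obtain ⟨j, rfl⟩ := exists_entry (π := π) h3 h4
    rw [blockIdx, blockIdx, time_entry, time_entry] at h6
    refine ⟨i, j, by rintro rfl; exact h5 rfl, (sameRun_iff i j).2 h6, (kept_iff h i).1 h7,
      (kept_iff h j).1 h8, ?_, ?_⟩
    · rw [hS, mem_clipTriangle h i ha, mem_clipTriangle h i hb]
      exact ⟨h9, h10⟩
    · rw [hS, mem_clipTriangle h j ha, mem_clipTriangle h j hb]
      exact ⟨h11, h12⟩

namespace HasLongRuns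

/-- An inner kept vertex is the tip of its own triangle. The two outer ones lie in the triangle cut
off last, which ends a run and hence does not start one. -/
theorem survives_of_kept (hd : HasLongRuns π k) (h : Avoids312 π) {a : ℕ} (ha : a ≤ n + 1)
    (hk : Kept π a) : Survives (chordsOf n (time π)) π (vtx n a) := by
  rw [survives_iff h ha]
  by_cases hin : 1 ≤ a ∧ a ≤ n
  · exact ⟨a, hin.1, hin.2, hk, Or.inl rfl⟩
  · have hn := hd.pos
    have hroot := time_entry π ⟨n - 1, by omega⟩
    simp only at hroot
    have hvn := (π ⟨n - 1, by omega⟩).2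
    set v := (π ⟨n - 1, by omega⟩).val + 1 with hv
    have hlt : ∀ c, 1 ≤ c → c ≤ n → c ≠ v → time π c < time π v := fun c h1 h2 h3 => by
      have := time_lt (π := π) h1 h2
      have : time π c ≠ time π v := fun he => h3 (time_inj he this)
      omega
    refine ⟨v, by omega, hvn, ?_, Or.inr ⟨?_, ?_⟩⟩
    · by_contra hc
      refine hd.not_asc_of_not_kept h hc fun h1 => ?_
      omega
    · rw [time_outer (by omega : a = 0 ∨ n < a)]
      omega
    · rcases Nat.eq_zero_or_pos a with rfl | ha0
      · refine Or.inr ⟨by omega, fun c h1 h2 => ?_⟩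
        have := hlt c (by omega) (by omega) (by omega)
        rw [time_outer (Or.inl rfl)]
        omega
      · refine Or.inl ⟨by omega, fun c h1 h2 => ?_⟩
        have := hlt c (by omega) (by omega) (by omega)
        rw [time_outer (a := a) (by omega)]
        omega

/-- The side from the parent `v` to `a + 1` of the removed triangle is also a side of the triangle
cut off at `v`. -/
theorem survives_succ (hd : HasLongRuns π k) (h : Avoids312 π) {a : ℕ} (hk : ¬ Kept π a) :
    Survives (chordsOf n (time π)) π (vtx n (a + 1)) := by
  have hn := not_kept_inner hk
  rw [survives_iff h (by omega)]
  obtain ⟨v, h1, h2, h3, h4, h5, -⟩ := hd.exists_parent h hk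
  rw [Kept, not_le] at hk
  have hne : time π (a + 1) ≠ time π v := fun he => by
    have := time_inj he.symm (time_lt h1 (by omega))
    omega
  refine ⟨v, h1, by omega, h4, Or.inr ⟨by omega, Or.inl ⟨by omega, fun c h6 h7 => ?_⟩⟩⟩
  rcases Nat.lt_or_ge c a with h8 | h8
  · have := h5 c h6 h8
    omega
  · obtain rfl : c = a := by omega
    omega

/-- A gap joins the first entry of a run with its successor. -/
theorem not_kept_of_isGap (hd : HasLongRuns π k) (h : Avoids312 π) {a b : ℕ} (hab : a < b)
    (hb : b ≤ n + 1) (hg : s(vtx n a, vtx n b) ∈ polygonSides (n + 2))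
    (hs : Survives (chordsOf n (time π)) π (vtx n b)) {x : ℕ} (hx : ¬ Kept π x)
    (hxa : InTriangle π x a) (hxb : InTriangle π x b) : b = a + 1 ∧ ¬ Kept π a := by
  obtain ⟨v, h1, h2, h3, h4, h5, -⟩ := hd.exists_parent h hx
  have hx' := hx
  rw [Kept, not_le] at hx'
  -- The triangle cut off at a run start consists of its parent, itself and its successor.
  have key : ∀ c, InTriangle π x c → c = v ∨ c = x ∨ c = x + 1 := by
    rintro c (rfl | ⟨h6, h7 | h7⟩)
    · simp
    · right; right
      have := h7.1
      by_contra hc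
      have := h7.2 (x + 1) (by omega) (by omega)
      omega
    · left
      rcases lt_trichotomy c v with h8 | h8 | h8
      · have := h7.2 v h8 h2
        omega
      · exact h8
      · have := h5 c h8 h7.1
        omega
  rw [mem_sides hab hb] at hg
  rcases key a hxa with rfl | rfl | rfl
  · rcases key b hxb with rfl | rfl | rfl
    · omega
    -- If the parent is adjacent along the polygon, `x` is the tip of an ear and lies in no other
    -- triangle, so it does not survive.
    · exfalso
      obtain rfl : b = a + 1 := by omega
      obtain ⟨w, g1, g2, g3, g4⟩ := (survives_iff h hb).1 hs
      rcases g4 with g4 | ⟨g4, g5 | g5⟩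
      · exact hx (g4 ▸ g3)
      · rcases Nat.lt_or_ge w a with g6 | g6
        · have := g5.2 a g6 (by omega)
          omega
        · obtain rfl : w = a := by have := g5.1; omega
          omega
      · rcases Nat.lt_or_ge (a + 2) w with g6 | g6
        · have := g5.2 (a + 1 + 1) (by omega) g6
          omega
        · obtain rfl : w = a + 1 + 1 := by have := g5.1; omega
          omega
    · omega
  · exact ⟨by rcases key b hxb with rfl | rfl | rfl <;> omega, hx⟩
  · rcases key b hxb with rfl | rfl | rfl <;> omega

theorem time_le_kept {a b : ℕ} (hab : a ≤ b) (hc : ∀ c, a ≤ c → c < b → ¬ Kept π c) :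
    time π a ≤ time π b := by
  induction b, hab using Nat.le_induction with
  | base => exact le_rfl
  | succ m hm ih =>
    have h1 := ih fun c h1 h2 => hc c h1 (by omega)
    have h2 := hc m hm (by omega)
    rw [Kept] at h2
    omega

/-- In a stretch of run starts each side `{c, c + 1}` is a gap, so all its surviving vertices are
glued to the next kept one. -/
theorem eqvGen_gap (hd : HasLongRuns π k) (h : Avoids312 π) {a b : ℕ} (hab : a ≤ b)
    (hb : b ≤ n + 1) (hc : ∀ c, a ≤ c → c < b → ¬ Kept π c)
    (hs : Survives (chordsOf n (time π)) π (vtx n a)) :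
    Relation.EqvGen (IsGap (chordsOf n (time π)) π) (vtx n a) (vtx n b) := by
  induction b, hab using Nat.le_induction with
  | base => exact .refl _
  | succ m hm ih =>
    refine .trans _ _ _ (ih (by omega) fun c h1 h2 => hc c h1 (by omega)) (.rel _ _ ?_)
    have hm' := hc m hm (by omega)
    have hsm : Survives (chordsOf n (time π)) π (vtx n m) := by
      rcases eq_or_lt_of_le hm with rfl | h1
      · exact hs
      · have := hd.survives_succ h (hc (m - 1) (by omega) (by omega))
        rwa [Nat.sub_add_cancel (by omega)] at this
    rw [isGap_iff h (by omega) hb]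
    refine ⟨hsm, hd.survives_succ h hm', (mem_sides (by omega) hb).2 (Or.inl rfl), m, hm',
      Or.inl rfl, Or.inr ?_⟩
    rw [Kept, not_le] at hm'
    exact ⟨hm', Or.inl ⟨by omega, fun c _ _ => by omega⟩⟩

theorem count_kept_le (hd : HasLongRuns π k) (h : Avoids312 π) {a : ℕ} (ha : a ≤ n + 1) :
    Nat.count (Kept π) a ≤ n - k + 1 := by
  rw [← count_nth_kept π (n - k + 1), hd.nth_kept_last h]
  exact Nat.count_monotone _ ha

theorem count_kept_pos {a : ℕ} (ha : 1 ≤ a) : 1 ≤ Nat.count (Kept π) a := by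
  have h4 : Nat.count (Kept π) 1 ≤ Nat.count (Kept π) a := Nat.count_monotone _ ha
  rwa [Nat.count_succ, if_pos (kept_outer (Or.inl rfl)), Nat.count_zero] at h4

theorem nth_le (hd : HasLongRuns π k) (h : Avoids312 π) {x : ℕ} (hx : x ≤ n - k + 1) :
    Nat.nth (Kept π) x ≤ n + 1 := by
  rw [← hd.nth_kept_last h]
  exact (nth_kept_strictMono π).monotone hx

theorem not_kept_between {a x : ℕ} (hx : Nat.count (Kept π) a = x) {c : ℕ} (h1 : a ≤ c)
    (h2 : c < Nat.nth (Kept π) x) : ¬ Kept π c := fun hc => by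
  have h3 := Nat.count_monotone (Kept π) h1
  have h4 := Nat.count_monotone (Kept π) (show c + 1 ≤ Nat.nth (Kept π) x from h2)
  rw [Nat.count_succ, if_pos hc, count_nth_kept] at h4
  omega

theorem le_nth_count (a : ℕ) : a ≤ Nat.nth (Kept π) (Nat.count (Kept π) a) := by
  by_contra hc
  have := Nat.count_monotone (Kept π) (Nat.succ_le_of_lt (not_le.1 hc))
  rw [Nat.succ_eq_add_one, Nat.count_succ, if_pos (kept_nth _ _), count_nth_kept] at this
  omega

/-- Contracting the gaps turns visible chords that are not merged into visible chords. -/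
theorem vis_regionOrder (hd : HasLongRuns π k) (h : Avoids312 π) {a b : ℕ} (hb : b ≤ n + 1)
    (hv : Vis (time π) a b) (hm : ¬ IsMerged (chordsOf n (time π)) π s(vtx n a, vtx n b))
    (hlt : Nat.count (Kept π) a < Nat.count (Kept π) b) :
    Vis (regionOrder π) (Nat.count (Kept π) a) (Nat.count (Kept π) b) := by
  refine ⟨hlt, fun c h1 h2 => ?_⟩
  have haw : a < Nat.nth (Kept π) c := by
    by_contra hc
    have := Nat.count_monotone (Kept π) (not_lt.1 hc)
    rw [count_nth_kept] at this
    omega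
  have hwb : Nat.nth (Kept π) c < b := by
    by_contra hc
    have := Nat.count_monotone (Kept π) (not_lt.1 hc)
    rw [count_nth_kept] at this
    omega
  have hwk := kept_nth π c
  simp only [regionOrder]
  generalize Nat.nth (Kept π) c = w at haw hwb hwk
  have hwr : blockIdx π w < k := hd.blockIdx_lt_iff.2 (by omega)
  have hvw := hv.2 w haw hwb
  constructor
  · have hak : Kept π a := by
      by_contra hc
      rw [Kept, not_le] at hc
      rcases Nat.lt_or_ge (a + 1) b with h3 | h3
      · have := hv.2 (a + 1) (by omega) h3
        omega
      · omega
    rw [Nat.nth_count hak]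
    -- If `w` were in the run of `a`, the chord would be merged: the triangle below it is cut off at
    -- the highest inside vertex `v`, the one above it at `a`, and both belong to that run.
    refine lt_of_le_of_ne (blockIdx_mono hvw.1.le) fun he => hm ?_
    have ha := hd.blockIdx_lt_iff.1 (he ▸ hwr)
    obtain ⟨r, ⟨v, i1, i2, rfl⟩, i3, i4, i5⟩ := hv.exists_base (by omega)
    have hwv := i3 w haw hwb
    have hav : blockIdx π v = blockIdx π a :=
      le_antisymm (blockIdx_mono i4.le) (he ▸ blockIdx_mono hwv)
    have hvk : Kept π v := by
      by_contra hc
      have := time_le_of_not_kept h hc (hav.trans he.symm)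
      have := time_inj (π := π) (a := w) (b := v) (by omega) (time_lt (by omega) (by omega))
      subst this
      exact hc hwk
    have hab : time π a < time π b := by
      by_contra hc
      have hne : time π a ≠ time π b := fun h' => by
        have := time_inj h' (time_lt ha.1 ha.2)
        omega
      have hva : blockIdx π v = blockIdx π b :=
        le_antisymm (blockIdx_mono i5.le) (hav ▸ blockIdx_mono (not_lt.1 hc))
      have := run_decreasing' (π := π) (a := v) (b := b) i5
        (by have := time_lt (π := π) ha.1 ha.2; omega) hva
      omega
    have hin : ∀ c, a < c → c < b → c ≠ v → time π c < time π v := fun c j1 j2 j3 => by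
      refine lt_of_le_of_ne (i3 c j1 j2) fun he' => j3 (time_inj he' (time_lt ?_ ?_)) <;> omega
    rw [isMerged_iff h (by omega) hb]
    refine ⟨v, a, by omega, by omega, ha.1, ha.2, by omega, hav, hvk, hak,
      Or.inr ⟨i4, Or.inr ⟨i1, fun c j1 j2 => ?_⟩⟩, Or.inr ⟨i5, Or.inl ⟨i2, fun c j1 j2 => ?_⟩⟩,
      Or.inl rfl, Or.inr ⟨hab, Or.inl hv⟩⟩
    · have := hin c j1 (by omega) (by omega)
      omega
    · have := hin c (by omega) j2 (by omega)
      omega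
  -- The right end may be glued to a later kept vertex `b'`, which is deleted no earlier. It cannot
  -- share the run of `w`, because runs decrease and `w < b'`.
  · have h3 := le_nth_count (π := π) b
    have h4 : time π b ≤ time π (Nat.nth (Kept π) (Nat.count (Kept π) b)) :=
      time_le_kept h3 fun c j1 j2 => not_kept_between rfl j1 j2
    generalize Nat.nth (Kept π) (Nat.count (Kept π) b) = b' at h3 h4
    refine lt_of_le_of_ne (blockIdx_mono (by omega)) fun he => ?_
    have hb' := hd.blockIdx_lt_iff.1 (he ▸ hwr)
    have := run_decreasing' (π := π) (a := w) (b := b') (by omega) (time_lt hb'.1 hb'.2) he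
    omega

/-- Every visible chord of the contracted polygon comes from a visible chord that is not
merged. -/
theorem exists_vis_of_regionOrder (hd : HasLongRuns π k) (h : Avoids312 π) {x y : ℕ}
    (hy : y ≤ n - k + 1) (hxy : x + 2 ≤ y) (hv : Vis (regionOrder π) x y) :
    ∃ a b, a + 2 ≤ b ∧ b ≤ n + 1 ∧ Vis (time π) a b ∧
      ¬ IsMerged (chordsOf n (time π)) π s(vtx n a, vtx n b) ∧
      Nat.count (Kept π) a = x ∧ Nat.count (Kept π) b = y := by
  have hmono := nth_kept_strictMono π
  set a := Nat.nth (Kept π) x with ha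
  set c0 := Nat.nth (Kept π) (y - 1) with hc0
  set b' := Nat.nth (Kept π) y with hb'
  have hac : a < c0 := hmono (show x < y - 1 by omega)
  have hcb : c0 < b' := hmono (show y - 1 < y by omega)
  have hb'n : b' ≤ n + 1 := hd.nth_le h hy
  have hcc : Nat.count (Kept π) (c0 + 1) = y := by
    rw [Nat.count_succ, if_pos (kept_nth _ _), count_nth_kept]; omega
  have hheads : ∀ c, c0 < c → c < b' → ¬ Kept π c := fun c h1 h2 =>
    not_kept_between hcc h1 h2
  -- every vertex strictly between is dominated by a kept one
  have hdom : ∀ c, a < c → c ≤ c0 → ∃ w, a < w ∧ w ≤ c0 ∧ Kept π w ∧ time π c ≤ time π w ∧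
      blockIdx π w < blockIdx π a ∧ blockIdx π w < blockIdx π b' := fun c h1 h2 => by
    have h3 := le_nth_count (π := π) c
    have h4 : time π c ≤ time π (Nat.nth (Kept π) (Nat.count (Kept π) c)) :=
      time_le_kept h3 fun c j1 j2 => not_kept_between rfl j1 j2
    have h5 := Nat.count_monotone (Kept π) h2
    rw [count_nth_kept] at h5
    have h6 := Nat.count_monotone (Kept π) (Nat.succ_le_of_lt h1)
    rw [Nat.succ_eq_add_one, Nat.count_succ, if_pos (kept_nth _ _), count_nth_kept] at h6
    have h7 := hv.2 (Nat.count (Kept π) c) (by omega) (by omega)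
    exact ⟨_, by omega, hmono.monotone h5, kept_nth _ _, h4, h7⟩
  have htime : ∀ u w, blockIdx π u < blockIdx π w → time π u < time π w := fun u w huw => by
    by_contra hc
    have := blockIdx_mono (not_lt.1 hc)
    omega
  have hdomt : ∀ c, a < c → c ≤ c0 → time π c < time π a ∧ time π c < time π b' :=
    fun c h1 h2 => by
      obtain ⟨w, -, -, -, h3, h4, h5⟩ := hdom c h1 h2
      have := htime _ _ h4
      have := htime _ _ h5
      omega
  -- Several vertices may be glued to `b'`; take the first that outlives everything between `a` and
  -- `c0`, which makes it visible from `a`.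
  obtain ⟨b, hb1, hb2, hb3, hb4⟩ := exists_first_after
    (P := fun b => ∀ c, a < c → c ≤ c0 → time π c < time π b) (x := c0) (b := b')
    (fun c h1 h2 => (hdomt c h1 h2).2) hcb
  have hvis : Vis (time π) a b := by
    refine ⟨by omega, fun c h1 h2 => ?_⟩
    rcases Nat.lt_or_ge c0 c with h3 | h3
    · have := hb4 c h3 h2
      push Not at this
      obtain ⟨d, j1, j2, j3⟩ := this
      have := hb3 d j1 j2
      have := hdomt d j1 j2
      omega
    · exact ⟨(hdomt c h1 h3).1, hb3 c h1 h3⟩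
  have hcount : Nat.count (Kept π) b = y := by
    rw [← hcc, eq_comm, count_eq_iff (by omega)]
    exact fun j j1 j2 => hheads j (by omega) (by omega)
  refine ⟨a, b, by omega, by omega, hvis, ?_, count_nth_kept π x, hcount⟩
  rw [isMerged_iff h (by omega) (by omega)]
  rintro ⟨v, w, hv1, hv2, hw1, hw2, hne, hbl, hvk, hwk, hva, hvb, hwa, hwb⟩
  -- a kept vertex inside the chord lies in a lower block than the kept ends
  have hlow : ∀ v, a < v → v < b → Kept π v →
      blockIdx π v < blockIdx π a ∧ blockIdx π v < blockIdx π b' := fun v h1 h2 h3 => by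
    have h4 : v ≤ c0 := by
      by_contra hc
      exact hheads v (by omega) (by omega) h3
    have h5 : Nat.count (Kept π) v < y := by
      have := Nat.count_monotone (Kept π) h4
      rw [count_nth_kept] at this
      omega
    have h6 := Nat.count_monotone (Kept π) (Nat.succ_le_of_lt h1)
    rw [Nat.succ_eq_add_one, Nat.count_succ, if_pos (kept_nth _ _), count_nth_kept] at h6
    have h7 := hv.2 (Nat.count (Kept π) v) (by omega) h5
    rw [regionOrder, regionOrder, regionOrder, Nat.nth_count h3] at h7
    exact h7
  have hbk : Kept π b → b = b' := fun hk => by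
    by_contra hc
    exact hheads b hb1 (by omega) hk
  -- A triangle on the chord is cut off inside it or at the end that is deleted first. Kept inside
  -- vertices belong to lower runs than kept ends, so two such triangles cannot be merged.
  have hcase : ∀ v, InTriangle π v a → InTriangle π v b →
      (a < v ∧ v < b) ∨ (v = a ∧ time π a < time π b) ∨ (v = b ∧ time π b < time π a) := by
    intro v h1 h2
    have hab := hvis.1
    rcases h1 with rfl | ⟨h1, h3⟩
    · rcases h2 with h2 | ⟨h2, -⟩
      · omega
      · exact Or.inr (Or.inl ⟨rfl, h2⟩)
    · rcases h2 with rfl | ⟨h2, h4⟩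
      · exact Or.inr (Or.inr ⟨rfl, h1⟩)
      · left
        by_contra hc
        have hva : v ≠ a := by rintro rfl; omega
        have hvb : v ≠ b := by rintro rfl; omega
        rcases Nat.lt_or_ge v a with h5 | h5
        · rcases h4 with h4 | h4
          · have := h4.2 a h5 hab
            omega
          · have := h4.1
            omega
        · rcases h3 with h3 | h3
          · have := h3.1
            omega
          · have := h3.2 b hab (by omega)
            omega
  rcases hcase v hva hvb with h1 | ⟨rfl, h1⟩ | ⟨rfl, h1⟩ <;>
    rcases hcase w hwa hwb with h2 | ⟨rfl, h2⟩ | ⟨rfl, h2⟩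
  · -- both inside: both are maximal on the interior
    have key : ∀ v w, a < v → v < b → a < w → w < b → InTriangle π v a → InTriangle π v b →
        w ≠ v → time π w < time π v := by
      intro v w i1 i2 i3 i4 i5 i6 i7
      rcases Nat.lt_or_ge w v with i8 | i8
      · rcases i5 with i5 | ⟨-, i5 | i5⟩
        · omega
        · have := i5.1; omega
        · exact (i5.2 w i3 i8).2
      · rcases i6 with i6 | ⟨-, i6 | i6⟩
        · omega
        · exact (i6.2 w (by omega) i4).1
        · have := i6.1; omega
    have := key v w h1.1 h1.2 h2.1 h2.2 hva hvb hne.symm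
    have := key w v h2.1 h2.2 h1.1 h1.2 hwa hwb hne
    omega
  · have := hlow v h1.1 h1.2 hvk
    omega
  · have := hlow v h1.1 h1.2 hvk
    rw [hbk hwk] at hbl
    omega
  · have := hlow w h2.1 h2.2 hwk
    omega
  · exact hne rfl
  · omega
  · have := hlow w h2.1 h2.2 hwk
    rw [hbk hvk] at hbl
    omega
  · omega
  · exact hne rfl

/-- The chords of the region order result from the triangulation of `π` by removing the
triangles of the first entries of the runs and merging the others. -/
theorem closesUpTo (hd : HasLongRuns π k) (h : Avoids312 π) :
    ClosesUpTo (chordsOf n (time π)) π (chordsOf (n - k) (regionOrder π)) := by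
  -- The new coordinate counts the kept vertices strictly before, so a run start shares it with the
  -- next kept vertex.
  let ρ : Fin (n + 2) → Fin (n - k + 2) := fun v => vtx (n - k) (Nat.count (Kept π) (lin v))
  have hρ : ∀ a, a ≤ n + 1 → ρ (vtx n a) = vtx (n - k) (Nat.count (Kept π) a) := fun a ha => by
    simp only [ρ, lin_vtx ha]
  have hcount : ∀ u v, ρ u = ρ v ↔
      Nat.count (Kept π) (lin u) = Nat.count (Kept π) (lin v) := fun u v => by
    refine ⟨fun he => ?_, fun he => by simp only [ρ, he]⟩
    exact vtx_inj (hd.count_kept_le h (lin_le u)) (hd.count_kept_le h (lin_le v)) he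
  refine ⟨ρ, ?_, ?_, ?_, ?_⟩
  · intro u v _ _ huv
    obtain ⟨a, ha, rfl⟩ := exists_vtx u
    obtain ⟨b, hb, rfl⟩ := exists_vtx v
    rw [hρ a ha, hρ b hb]
    have hcb := hd.count_kept_le h hb
    have hca := hd.count_kept_le h ha
    rcases Nat.eq_zero_or_pos b with rfl | hb0
    · rw [Nat.count_zero, Fin.le_def, vtx_zero_val]
      omega
    · have hb1 := count_kept_pos (π := π) hb0
      rcases Nat.eq_zero_or_pos a with rfl | ha0
      · rw [Fin.le_def, vtx_zero_val, vtx_val hb0 hb] at huv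
        omega
      · have ha1 := count_kept_pos (π := π) ha0
        rw [Fin.le_def, vtx_val ha0 ha, vtx_val hb0 hb] at huv
        have := Nat.count_monotone (Kept π) (show a ≤ b by omega)
        rw [Fin.le_def, vtx_val ha1 hca, vtx_val hb1 hcb]
        omega
  · intro u v hu hv
    constructor
    · intro he
      rw [hcount] at he
      obtain ⟨a, ha, rfl⟩ := exists_vtx u
      obtain ⟨b, hb, rfl⟩ := exists_vtx v
      rw [lin_vtx ha, lin_vtx hb] at he
      rcases le_total a b with hab | hab
      · exact hd.eqvGen_gap h hab hb ((count_eq_iff hab).1 he) hu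
      · exact .symm _ _ (hd.eqvGen_gap h hab ha ((count_eq_iff hab).1 he.symm) hv)
    · intro he
      clear hu hv
      induction he with
      | rel u v hg =>
        rw [hcount]
        obtain ⟨a, ha, rfl⟩ := exists_vtx u
        obtain ⟨b, hb, rfl⟩ := exists_vtx v
        rw [lin_vtx ha, lin_vtx hb]
        obtain ⟨h1, h2, h3, x, h4, h5, h6⟩ := (isGap_iff h ha hb).1 hg
        rcases lt_trichotomy a b with hab | rfl | hab
        · obtain ⟨rfl, hk⟩ := hd.not_kept_of_isGap h hab hb h3 h2 h4 h5 h6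
          rw [Nat.count_succ, if_neg hk]; rfl
        · rfl
        · rw [Sym2.eq_swap] at h3
          obtain ⟨rfl, hk⟩ := hd.not_kept_of_isGap h hab ha h3 h1 h4 h6 h5
          rw [Nat.count_succ, if_neg hk]; rfl
      | refl => rfl
      | symm _ _ _ ih => exact ih.symm
      | trans _ _ _ _ _ ih1 ih2 => exact ih1.trans ih2
  · intro x
    obtain ⟨y, hy, rfl⟩ := exists_vtx x
    have hle := hd.nth_le h hy
    exact ⟨vtx n (Nat.nth (Kept π) y), hd.survives_of_kept h hle (kept_nth _ _), by
      rw [hρ _ hle, count_nth_kept]⟩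
  · intro e
    constructor
    · intro he
      have hdiag := isDiagonal_of_mem_chordsOf he
      obtain ⟨x, y, hy, rfl, hv⟩ := exists_of_mem_chordsOf he
      have hxy := (isDiagonal_chord hv.1 hy).1 hdiag
      have := hv.1
      obtain ⟨a, b, h1, h2, h3, h4, h5, h6⟩ := hd.exists_vis_of_regionOrder h hy (by omega) hv
      refine ⟨hdiag, s(vtx n a, vtx n b), ?_, h4, ?_⟩
      · rw [mem_chordsOf (by omega) h2]
        refine ⟨by omega, ?_, h3⟩
        rintro ⟨rfl, rfl⟩
        rw [Nat.count_zero] at h5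
        rw [← count_nth_kept π (n - k + 1), hd.nth_kept_last h] at hxy
        exact hxy.2 ⟨h5.symm, h6.symm⟩
      · rw [Sym2.map_mk, hρ a (by omega), hρ b h2, h5, h6]
    · rintro ⟨hdiag, d, hdT, hm, rfl⟩
      obtain ⟨a, b, hb, rfl, hv⟩ := exists_of_mem_chordsOf hdT
      have hab := hv.1
      have hbn := hd.count_kept_le h hb
      rw [Sym2.map_mk, hρ a (by omega), hρ b hb] at hdiag ⊢
      have hlt : Nat.count (Kept π) a < Nat.count (Kept π) b := by
        refine lt_of_le_of_ne (Nat.count_monotone _ hab.le) fun he => ?_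
        rw [he] at hdiag
        exact hdiag.1 (by simp)
      rw [mem_chordsOf hlt hbn]
      have := (isDiagonal_chord hlt hbn).1 hdiag
      exact ⟨this.1, this.2, hd.vis_regionOrder h hb hv hm hlt⟩

end HasLongRuns

end Triangles

/-! ### Rebuilding the permutation from a region order by two sorting keys. -/

/-- The right end of the chord above the region of rank `r`. -/
noncomputable def topEnd (q : ℕ → ℕ) (r : ℕ) : ℕ :=
  sInf {w | ∃ z, 1 ≤ z ∧ z < w ∧ q z = r ∧ r < q w}

theorem topEnd_le {q : ℕ → ℕ} {r z w : ℕ} (h1 : 1 ≤ z) (h2 : z < w) (h3 : q z = r)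
    (h4 : r < q w) : topEnd q r ≤ w :=
  Nat.sInf_le ⟨z, h1, h2, h3, h4⟩

namespace IsRegionOrder

variable {M k : ℕ} {q : ℕ → ℕ}

theorem topEnd_spec (H : IsRegionOrder M k q) {r : ℕ} (hr : r < k) :
    topEnd q r ≤ M + 1 ∧ ∃ z, 1 ≤ z ∧ z < topEnd q r ∧ q z = r ∧ r < q (topEnd q r) := by
  obtain ⟨z, h1, h2, h3⟩ := H.surj r hr
  have h4 : r < q (M + 1) := by rwa [H.top (M + 1) (by omega)]
  exact ⟨topEnd_le h1 (by omega) h3 h4,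
    Nat.sInf_mem (s := {w | ∃ z, 1 ≤ z ∧ z < w ∧ q z = r ∧ r < q w})
      ⟨M + 1, z, h1, by omega, h3, h4⟩⟩

/-- In postorder the right ends increase weakly: a vertex of rank `r' ≤ r` beyond the right end of
region `r` would violate `avoid`. -/
theorem topEnd_mono (H : IsRegionOrder M k q) {r r' : ℕ} (hr : r < k) (h : r' ≤ r) :
    topEnd q r' ≤ topEnd q r := by
  obtain ⟨h1, z, h2, h3, h4, h5⟩ := H.topEnd_spec hr
  obtain ⟨z', g1, g2, g3⟩ := H.surj r' (by omega)
  rcases lt_trichotomy z' (topEnd q r) with h6 | h6 | h6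
  · exact topEnd_le g1 h6 g3 (by omega)
  · rw [← h6] at h5
    omega
  · have := H.avoid z (topEnd q r) z' h2 h3 h6 g2 (by omega)
    omega

theorem lt_topEnd (H : IsRegionOrder M k q) {x : ℕ} (h1 : 1 ≤ x) (h2 : x ≤ M) :
    x < topEnd q (q x) := by
  obtain ⟨h3, z, h4, h5, h6, h7⟩ := H.topEnd_spec (H.lt x h1 h2)
  rcases lt_trichotomy x (topEnd q (q x)) with h | h | h
  · exact h
  · rw [← h] at h7
    omega
  · have := H.avoid z _ x h4 h5 h h2 (by omega)
    omega

end IsRegionOrder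

section Keys

variable {M k : ℕ} {q : ℕ → ℕ}

/-- The order of the first entries of the runs (`inl`) and of the other entries (`inr`) by
their size. -/
noncomputable def valKey (q : ℕ → ℕ) : Fin k ⊕ Fin M → ℕ ×ₗ ℕ
  -- A run start lies just below the kept letter numbered `topEnd q r`, whose second component `k`
  -- exceeds every rank.
  | .inl r => toLex (topEnd q r, r.val)
  | .inr x => toLex (x.val + 1, k)

/-- The order of the first entries of the runs (`inl`) and of the other entries (`inr`) by
their position. -/
def posKey (q : ℕ → ℕ) : Fin k ⊕ Fin M → ℕ ×ₗ ℕ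
  -- The start comes first in its run because `M - x.val` is positive; the other entries of the run
  -- then decrease.
  | .inl r => toLex (r.val, 0)
  | .inr x => toLex (q (x.val + 1), M - x.val)

theorem toLex_lt {a b c d : ℕ} : (toLex (a, b) : ℕ ×ₗ ℕ) < toLex (c, d) ↔
    a < c ∨ (a = c ∧ b < d) := by
  rw [Prod.Lex.lt_iff]; rfl

theorem valKey_injective : Function.Injective (valKey q : Fin k ⊕ Fin M → ℕ ×ₗ ℕ) := by
  rintro (r | x) (s | y) h <;> simp only [valKey, toLex_inj, Prod.mk.injEq] at h
  · rw [Fin.ext h.2]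
  · omega
  · omega
  · rw [Fin.ext (show x.val = y.val by omega)]

theorem posKey_injective : Function.Injective (posKey q : Fin k ⊕ Fin M → ℕ ×ₗ ℕ) := by
  rintro (r | x) (s | y) h <;> simp only [posKey, toLex_inj, Prod.mk.injEq] at h
  · rw [Fin.ext h.1]
  · omega
  · omega
  · rw [Fin.ext (show x.val = y.val by omega)]

/-- A first entry of a run exceeds all entries that precede it. -/
theorem valKey_lt_inl (H : IsRegionOrder M k q) {A : Fin k ⊕ Fin M} {r : Fin k}
    (h : posKey q A < posKey q (.inl r : Fin k ⊕ Fin M)) :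
    valKey q A < valKey q (.inl r : Fin k ⊕ Fin M) := by
  rcases A with s | x <;> simp only [posKey, valKey, toLex_lt] at h ⊢
  · have := H.topEnd_mono r.2 (show s.val ≤ r.val by omega)
    omega
  · left
    obtain ⟨h1, z, h2, h3, h4, h5⟩ := H.topEnd_spec r.2
    by_contra hc
    rcases eq_or_lt_of_le (not_lt.1 hc) with h6 | h6
    · rw [h6] at h5
      omega
    · have := H.avoid z _ (x.val + 1) h2 h3 h6 (by omega) (by omega)
      omega

/-- The letters `1` and `2` follow a larger one, so neither starts a run. If `3` does not either,
`avoid` applies to `q`; if it starts run `r`, then `c` lies left of the right end of region `r`,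
which is impossible as `b < c` has a smaller rank, at least `r`, than `c`. -/
theorem keys_avoid (H : IsRegionOrder M k q) {A B C : Fin k ⊕ Fin M}
    (h1 : posKey q A < posKey q B) (h2 : posKey q B < posKey q C)
    (h3 : valKey q B < valKey q C) (h4 : valKey q C < valKey q A) : False := by
  rcases C with t | c
  · exact lt_asymm h4 (valKey_lt_inl H (h1.trans h2))
  rcases B with s | b
  · exact lt_asymm (h3.trans h4) (valKey_lt_inl H h1)
  rcases A with r | a <;> simp only [posKey, valKey, toLex_lt] at h1 h2 h3 h4
  · have hbc : b.val < c.val := by omega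
    have hq : q (b.val + 1) < q (c.val + 1) := by omega
    obtain ⟨h5, z, h6, h7, h8, h9⟩ := H.topEnd_spec r.2
    rcases Nat.lt_or_ge r (q (b.val + 1)) with h10 | h10
    · rcases lt_trichotomy z (c.val + 1) with h11 | rfl | h11
      · have := topEnd_le h6 h11 h8 (by omega)
        omega
      · omega
      · have := H.avoid (b.val + 1) (c.val + 1) z (by omega) (by omega) h11
          (by omega) (by omega)
        omega
    · have := topEnd_le (q := q) (r := r) (z := b.val + 1) (w := c.val + 1) (by omega) (by omega)
        (by omega) (by omega)
      omega
  · have := H.avoid (b.val + 1) (c.val + 1) (a.val + 1) (by omega) (by omega) (by omega) (by omega)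
      (by omega)
    omega

/-- The permutation `π` has the region order `q`: its entries, sorted by size and by position,
are ordered by the two keys. -/
def Represents {n : ℕ} (M k : ℕ) (q : ℕ → ℕ) (π : Equiv.Perm (Fin n)) : Prop :=
  ∃ g : Fin n ≃ Fin k ⊕ Fin M, StrictMono (valKey q ∘ g) ∧ StrictMono (posKey q ∘ g ∘ π)

theorem eq_of_strictMono_comp {n : ℕ} {X : Type} {f : X → ℕ ×ₗ ℕ} {g g' : Fin n → X}
    (hf : Function.Injective f) (hg : Function.Surjective g) (hg' : Function.Surjective g')
    (h : StrictMono (f ∘ g)) (h' : StrictMono (f ∘ g')) : g = g' := by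
  have : f ∘ g = f ∘ g' := by
    rw [← h.range_inj h', hg.range_comp, hg'.range_comp]
  funext v
  exact hf (congrFun this v)

/-- Sorting by an injective key has only one outcome: the value key fixes `g`, and the position key
then fixes `π`. -/
theorem Represents.unique {n : ℕ} {π π' : Equiv.Perm (Fin n)} (h : Represents M k q π)
    (h' : Represents M k q π') : π = π' := by
  obtain ⟨g, h1, h2⟩ := h
  obtain ⟨g', h1', h2'⟩ := h'
  have e1 : (g : Fin n → _) = g' :=
    eq_of_strictMono_comp valKey_injective g.surjective g'.surjective h1 h1'
  have e2 : g ∘ π = g' ∘ π' := eq_of_strictMono_comp posKey_injective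
    (g.surjective.comp π.surjective) (g'.surjective.comp π'.surjective) h2 h2'
  refine Equiv.ext fun i => g.injective ?_
  have := congrFun e2 i
  rw [Function.comp, Function.comp, ← e1] at this
  exact this

theorem exists_equiv_strictMono {n : ℕ} {X : Type} [Fintype X] (hX : Fintype.card X = n)
    {f : X → ℕ ×ₗ ℕ} (hf : Function.Injective f) : ∃ g : Fin n ≃ X, StrictMono (f ∘ g) := by
  let _ : LinearOrder X := LinearOrder.lift' f hf
  let e : Fin n ≃o X := Fintype.orderIsoFinOfCardEq X hX
  exact ⟨e.toEquiv, fun a b hab => e.strictMono hab⟩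

theorem exists_represents {n : ℕ} (hn : k + M = n) (q : ℕ → ℕ) :
    ∃ π : Equiv.Perm (Fin n), Represents M k q π := by
  have hX : Fintype.card (Fin k ⊕ Fin M) = n := by simp [hn]
  obtain ⟨g, hg⟩ := exists_equiv_strictMono hX (valKey_injective (q := q))
  obtain ⟨g', hg'⟩ := exists_equiv_strictMono hX (posKey_injective (q := q))
  refine ⟨g'.trans g.symm, g, hg, ?_⟩
  have : (g : Fin n → _) ∘ (g'.trans g.symm) = g' := by
    funext i; simp
  rwa [this]

end Keys

/-! ### The rebuilt permutation has the prescribed region order. -/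

section Construct

variable {n M k : ℕ} {q : ℕ → ℕ} {π : Equiv.Perm (Fin n)} {g : Fin n ≃ Fin k ⊕ Fin M}

theorem avoids312_of_keys (H : IsRegionOrder M k q) (h1 : StrictMono (valKey q ∘ g))
    (h2 : StrictMono (posKey q ∘ g ∘ π)) : Avoids312 π := fun _ _ _ hij hjl hv =>
  keys_avoid H (h2 hij) (h2 hjl) (h1 hv.1) (h1 hv.2)

/-- A run start exceeds everything before it. A kept letter comes after the start of its own rank,
so its predecessor has the same rank and is larger, either as that start (`lt_topEnd`) or by the
decreasing order within the run. -/
theorem asc_iff_isLeft (H : IsRegionOrder M k q) (h1 : StrictMono (valKey q ∘ g))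
    (h2 : StrictMono (posKey q ∘ g ∘ π)) {j : ℕ} (hj : j + 1 < n) :
    Asc π j ↔ (g (π ⟨j + 1, hj⟩)).isLeft = true := by
  have hlt : posKey q (g (π ⟨j, by omega⟩)) < posKey q (g (π ⟨j + 1, hj⟩)) :=
    h2 (show (⟨j, by omega⟩ : Fin n) < ⟨j + 1, hj⟩ by simp [Fin.lt_def])
  rcases hX : g (π ⟨j + 1, hj⟩) with r | x
  · refine ⟨fun _ => rfl, fun _ _ => h1.lt_iff_lt.1 ?_⟩
    rw [hX] at hlt
    simp only [Function.comp, hX]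
    exact valKey_lt_inl H hlt
  · refine ⟨fun h => ?_, fun h => by simp at h⟩
    exfalso
    have h3 := h1 (h hj)
    simp only [Function.comp, hX] at h3
    have hx := H.lt (x.val + 1) (by omega) (by omega)
    obtain ⟨i, hi⟩ : ∃ i, g (π i) = .inl ⟨q (x.val + 1), hx⟩ :=
      ⟨π.symm (g.symm (.inl ⟨q (x.val + 1), hx⟩)), by simp⟩
    have h4 : i < ⟨j + 1, hj⟩ := by
      refine h2.lt_iff_lt.1 ?_
      simp only [Function.comp, hX, hi, posKey, toLex_lt]
      exact Or.inr ⟨trivial, by omega⟩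
    have h5 : posKey q (g (π i)) ≤ posKey q (g (π ⟨j, by omega⟩)) :=
      h2.monotone (show i ≤ ⟨j, by omega⟩ by
        rw [Fin.lt_def] at h4; rw [Fin.le_def]; simp at h4 ⊢; omega)
    rw [hX] at hlt
    rw [hi] at h5
    rcases hY : g (π ⟨j, by omega⟩) with r | y <;> rw [hY] at hlt h3 h5 <;>
      rw [← not_lt] at h5 <;> simp only [posKey, valKey, toLex_lt] at hlt h3 h5
    · have := H.lt_topEnd (x := x.val + 1) (by omega) (by omega)
      rw [show q (x.val + 1) = r.val by omega] at this
      omega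
    · omega

/-- Every rank is attained by some kept letter, which must come between this start and the next;
this gives runs of length at least two. -/
theorem isRight_succ_of_isLeft (H : IsRegionOrder M k q) (h2 : StrictMono (posKey q ∘ g ∘ π))
    {j : Fin n} (hj : (g (π j)).isLeft = true) :
    ∃ h : j.val + 1 < n, (g (π ⟨j.val + 1, h⟩)).isLeft = false := by
  rcases hX : g (π j) with r | x
  swap
  · rw [hX] at hj; simp at hj
  obtain ⟨z, h3, h4, h5⟩ := H.surj r r.2
  obtain ⟨i, hi⟩ : ∃ i, g (π i) = .inr ⟨z - 1, by omega⟩ :=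
    ⟨π.symm (g.symm (.inr ⟨z - 1, by omega⟩)), by simp⟩
  have e : z - 1 + 1 = z := by omega
  have h6 : j < i := by
    refine h2.lt_iff_lt.1 ?_
    simp only [Function.comp, hX, hi, posKey, toLex_lt, e]
    omega
  have h6' : j.val < i.val := h6
  have hjn : j.val + 1 < n := by omega
  refine ⟨hjn, ?_⟩
  have h7 : posKey q (g (π ⟨j.val + 1, hjn⟩)) ≤ posKey q (g (π i)) :=
    h2.monotone (show (⟨j.val + 1, hjn⟩ : Fin n) ≤ i by rw [Fin.le_def]; exact h6')
  have h8 : posKey q (g (π j)) < posKey q (g (π ⟨j.val + 1, hjn⟩)) :=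
    h2 (show j < ⟨j.val + 1, hjn⟩ by simp [Fin.lt_def])
  rcases hY : g (π ⟨j.val + 1, hjn⟩) with s | y
  · exfalso
    rw [hY, hi, ← not_lt] at h7
    rw [hX, hY] at h8
    simp only [posKey, toLex_lt, e] at h7 h8
    omega
  · rfl

theorem isLeft_zero (H : IsRegionOrder M k q) (h2 : StrictMono (posKey q ∘ g ∘ π)) (hn : 0 < n) :
    (g (π ⟨0, hn⟩)).isLeft = true := by
  rcases hX : g (π ⟨0, hn⟩) with r | x
  · rfl
  · exfalso
    have hx := H.lt (x.val + 1) (by omega) (by omega)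
    obtain ⟨i, hi⟩ : ∃ i, g (π i) = .inl ⟨q (x.val + 1), hx⟩ :=
      ⟨π.symm (g.symm (.inl ⟨q (x.val + 1), hx⟩)), by simp⟩
    have h4 : i < ⟨0, hn⟩ := by
      refine h2.lt_iff_lt.1 ?_
      simp only [Function.comp, hX, hi, posKey, toLex_lt]
      exact Or.inr ⟨trivial, by omega⟩
    simp [Fin.lt_def] at h4

theorem hasLongRuns_of_keys (H : IsRegionOrder M k q) (hn : 0 < n)
    (h1 : StrictMono (valKey q ∘ g)) (h2 : StrictMono (posKey q ∘ g ∘ π)) :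
    HasLongRuns π k := by
  classical
  refine ⟨?_, fun h => ?_, fun j hj hasc hasc' => ?_⟩
  · let P : ℕ → Prop := fun i => ∀ h : i < n, (g (π ⟨i, h⟩)).isLeft = true
    have e1 : Nat.count (Asc π) n = Nat.count (fun j => P (j + 1)) n := by
      rw [Nat.count_eq_card_filter_range, Nat.count_eq_card_filter_range]
      refine congrArg Finset.card (Finset.filter_congr fun j hj => ?_)
      by_cases hj' : j + 1 < n
      · rw [asc_iff_isLeft H h1 h2 hj']
        exact ⟨fun h _ => h, fun h => h hj'⟩
      · exact ⟨fun _ h => absurd h hj', fun _ h => absurd h hj'⟩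
    -- Shifting from run ends to run starts drops position `0`, which is a start, and gains the
    -- vacuous position `n`; the count is unchanged.
    have e2 := Nat.count_succ' P n
    rw [Nat.count_succ, if_pos (show P n from fun h => absurd h (lt_irrefl _)),
      if_pos (show P 0 from fun h => isLeft_zero H h2 h)] at e2
    rw [e1, ← Nat.add_right_cancel e2, Nat.count_eq_card_filter_range]
    refine Eq.trans (Eq.symm ?_) (Finset.card_fin k)
    refine Finset.card_bij (fun r _ => (π.symm (g.symm (.inl r))).val) ?_ ?_ ?_
    · intro r _
      simp only [Finset.mem_filter, Finset.mem_range, Fin.is_lt, true_and, P]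
      intro _
      simp
    · intro r _ s _ he
      simpa using Fin.ext he
    · intro i hi
      simp only [Finset.mem_filter, Finset.mem_range, P] at hi
      have := hi.2 hi.1
      rcases hX : g (π ⟨i, hi.1⟩) with r | x
      · refine ⟨r, Finset.mem_univ _, ?_⟩
        rw [← hX]; simp
      · rw [hX] at this; simp at this
  · obtain ⟨h3, h4⟩ := isRight_succ_of_isLeft H h2 (isLeft_zero H h2 hn)
    rw [asc_iff_isLeft H h1 h2 h3] at h
    rw [h] at h4
    simp at h4
  · rw [asc_iff_isLeft H h1 h2 hj] at hasc
    obtain ⟨h3, h4⟩ := isRight_succ_of_isLeft H h2 hasc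
    rw [asc_iff_isLeft H h1 h2 h3] at hasc'
    rw [hasc'] at h4
    simp at h4

theorem kept_iff_isRight (H : IsRegionOrder M k q) (h1 : StrictMono (valKey q ∘ g))
    (h2 : StrictMono (posKey q ∘ g ∘ π)) (i : Fin n) :
    Kept π ((π i).val + 1) ↔ (g (π i)).isLeft = false := by
  rw [kept_iff (avoids312_of_keys H h1 h2), isRunStart_iff, ← Bool.not_eq_true]
  refine not_congr ?_
  by_cases h0 : i.val = 0
  · have := isLeft_zero H h2 (show 0 < n by omega)
    have e : (⟨0, by omega⟩ : Fin n) = i := by ext; simp [h0]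
    rw [e] at this
    simp [h0, this]
  · have h3 : i.val - 1 + 1 < n := by omega
    have e : (⟨i.val - 1 + 1, h3⟩ : Fin n) = i := by ext; simp; omega
    rw [asc_iff_isLeft H h1 h2 h3, e]
    simp [h0]

/-- The kept vertices are the `inr` letters in their order, and their run indices compare as `q`
does; region orders with the same comparisons coincide. -/
theorem regionOrder_of_keys (H : IsRegionOrder (n - k) k q) {g : Fin n ≃ Fin k ⊕ Fin (n - k)}
    (hn : 0 < n) (h1 : StrictMono (valKey q ∘ g)) (h2 : StrictMono (posKey q ∘ g ∘ π)) :
    regionOrder π = q := by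
  have hd := hasLongRuns_of_keys H hn h1 h2
  have h := avoids312_of_keys H h1 h2
  have H' := hd.isRegionOrder h
  have hnth : (fun x : Fin (n - k) => Nat.nth (Kept π) (x.val + 1)) =
      fun x => (g.symm (.inr x)).val + 1 := by
    rw [← StrictMono.range_inj]
    · ext a
      constructor
      · rintro ⟨x, rfl⟩
        have h3 := kept_nth π (x.val + 1)
        have h4 := hd.nth_kept_inner h (x := x.val + 1) (by omega) (by omega)
        obtain ⟨i, hi⟩ := exists_entry (π := π) h4.1 h4.2
        rw [hi, kept_iff_isRight H h1 h2] at h3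
        rcases hX : g (π i) with r | y
        · rw [hX] at h3; simp at h3
        · refine ⟨y, ?_⟩
          simp only [← hX, Equiv.symm_apply_apply, hi]
      · rintro ⟨y, rfl⟩
        have h3 : Kept π ((g.symm (.inr y)).val + 1) := by
          have := kept_iff_isRight H h1 h2 (π.symm (g.symm (.inr y)))
          simp only [Equiv.apply_symm_apply] at this
          exact this.2 rfl
        have h4 := Nat.nth_count h3
        have h5 : Nat.count (Kept π) ((g.symm (.inr y)).val + 1) < n - k + 1 := by
          by_contra hc
          have := (nth_kept_strictMono π).monotone (not_lt.1 hc)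
          rw [h4, hd.nth_kept_last h] at this
          omega
        have h6 := HasLongRuns.count_kept_pos (π := π)
          (a := (g.symm (.inr y)).val + 1) (by omega)
        refine ⟨⟨Nat.count (Kept π) ((g.symm (.inr y)).val + 1) - 1, by omega⟩, ?_⟩
        simp only
        rw [Nat.sub_add_cancel h6, h4]
    · exact fun x y hxy => nth_kept_strictMono π (by rw [Fin.lt_def] at hxy; omega)
    · intro x y hxy
      have : g.symm (.inr x) < g.symm (.inr y) := by
        refine h1.lt_iff_lt.1 ?_
        simp only [Function.comp, Equiv.apply_symm_apply, valKey, toLex_lt]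
        rw [Fin.lt_def] at hxy
        omega
      rw [Fin.lt_def] at this
      simp only
      omega
  have hpos : ∀ x : Fin (n - k), ∃ i : Fin n, g (π i) = .inr x ∧
      regionOrder π (x.val + 1) = Nat.count (Asc π) i := fun x => by
    refine ⟨π.symm (g.symm (.inr x)), by simp, ?_⟩
    have := congrFun hnth x
    rw [regionOrder, this, blockIdx]
    have h3 := time_entry π (π.symm (g.symm (.inr x)))
    rw [Equiv.apply_symm_apply] at h3
    rw [h3]
  have heq : ∀ x y : Fin (n - k), q (x.val + 1) = q (y.val + 1) →
      regionOrder π (x.val + 1) = regionOrder π (y.val + 1) := by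
    have key : ∀ (x y : Fin (n - k)) (i j : Fin n), i ≤ j → g (π i) = .inr x → g (π j) = .inr y →
        q (x.val + 1) = q (y.val + 1) → Nat.count (Asc π) i = Nat.count (Asc π) j := by
      intro x y i j hij hi hj he
      rw [count_eq_iff (Fin.le_def.1 hij)]
      intro l h3 h4 hl
      have h5 : l + 1 < n := by omega
      rw [asc_iff_isLeft H h1 h2 h5] at hl
      have h6 : posKey q (g (π i)) < posKey q (g (π ⟨l + 1, h5⟩)) :=
        h2 (show i < ⟨l + 1, h5⟩ by rw [Fin.lt_def]; simp; omega)
      have h7 : posKey q (g (π ⟨l + 1, h5⟩)) ≤ posKey q (g (π j)) :=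
        h2.monotone (show (⟨l + 1, h5⟩ : Fin n) ≤ j by rw [Fin.le_def]; simp; omega)
      rcases hX : g (π ⟨l + 1, h5⟩) with r | z
      · rw [hX, hi] at h6
        rw [hX, hj, ← not_lt] at h7
        simp only [posKey, toLex_lt] at h6 h7
        omega
      · rw [hX] at hl; simp at hl
    intro x y he
    obtain ⟨i, hi, hi'⟩ := hpos x
    obtain ⟨j, hj, hj'⟩ := hpos y
    rw [hi', hj']
    rcases le_total i j with hij | hij
    · exact key x y i j hij hi hj he
    · exact (key y x j i hij hj hi he.symm).symm
  have hlt : ∀ x y : Fin (n - k), q (x.val + 1) < q (y.val + 1) →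
      regionOrder π (x.val + 1) < regionOrder π (y.val + 1) := by
    intro x y he
    obtain ⟨i, hi, hi'⟩ := hpos x
    obtain ⟨j, hj, hj'⟩ := hpos y
    rw [hi', hj']
    -- The start of the run of `y` lies between the two letters, and the ascent just before it
    -- raises the run index.
    have hy := H.lt (y.val + 1) (by omega) (by omega)
    obtain ⟨l, hl⟩ : ∃ l, g (π l) = .inl ⟨q (y.val + 1), hy⟩ :=
      ⟨π.symm (g.symm (.inl ⟨q (y.val + 1), hy⟩)), by simp⟩
    have h3 : i < l := by
      refine h2.lt_iff_lt.1 ?_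
      simp only [Function.comp, hi, hl, posKey, toLex_lt]
      omega
    have h4 : l < j := by
      refine h2.lt_iff_lt.1 ?_
      simp only [Function.comp, hj, hl, posKey, toLex_lt]
      exact Or.inr ⟨trivial, by omega⟩
    rw [Fin.lt_def] at h3 h4
    have h5 : l.val - 1 + 1 < n := by omega
    have h6 : Asc π (l.val - 1) := by
      rw [asc_iff_isLeft H h1 h2 h5]
      have e : (⟨l.val - 1 + 1, h5⟩ : Fin n) = l := by ext; simp; omega
      rw [e, hl]
      rfl
    have h7 := Nat.count_monotone (Asc π) (show i.val ≤ l.val - 1 by omega)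
    have h8 := Nat.count_monotone (Asc π) (show l.val - 1 + 1 ≤ j.val by omega)
    rw [Nat.count_succ, if_pos h6] at h8
    omega
  refine H'.eq_of_lt_iff H fun x y hx1 hx2 hy1 hy2 => ?_
  have hx := heq ⟨x - 1, by omega⟩ ⟨y - 1, by omega⟩
  have hxy := hlt ⟨x - 1, by omega⟩ ⟨y - 1, by omega⟩
  have hyx := hlt ⟨y - 1, by omega⟩ ⟨x - 1, by omega⟩
  simp only [Nat.sub_add_cancel hx1, Nat.sub_add_cancel hy1] at hx hxy hyx
  omega

end Construct

/-- A 312-avoiding permutation with long runs is determined by its region order. -/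
theorem HasLongRuns.represents {n k : ℕ} {π : Equiv.Perm (Fin n)} (hd : HasLongRuns π k)
    (h : Avoids312 π) : Represents (n - k) k (regionOrder π) π := by
  have H := hd.isRegionOrder h
  have hcard := hd.count_kept h
  have hle : Nat.count (Kept π) (n + 1) ≤ n - k + 1 := hd.count_kept_le h le_rfl
  have hkn : k ≤ n := by
    have := count_kept_pos (π := π) (a := n + 1) (by omega)
    omega
  have hblock : ∀ v : Fin n, blockIdx π (v.val + 1) < k := fun v =>
    hd.blockIdx_lt_iff.2 ⟨by omega, v.2⟩
  have hcount : ∀ v : Fin n, Kept π (v.val + 1) →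
      1 ≤ Nat.count (Kept π) (v.val + 1) ∧ Nat.count (Kept π) (v.val + 1) ≤ n - k :=
    fun v hv => by
      refine ⟨count_kept_pos (by omega), ?_⟩
      have := Nat.count_monotone (Kept π) (show v.val + 1 + 1 ≤ n + 1 by omega)
      rw [Nat.count_succ, if_pos hv] at this
      omega
  have hq : ∀ a, Kept π a → regionOrder π (Nat.count (Kept π) a) = blockIdx π a :=
    fun a ha => by rw [regionOrder, Nat.nth_count ha]
  have hclt : ∀ a b, Kept π a → a < b → Nat.count (Kept π) a < Nat.count (Kept π) b :=
    fun a b ha hab => by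
      have := Nat.count_monotone (Kept π) (Nat.succ_le_of_lt hab)
      rw [Nat.succ_eq_add_one, Nat.count_succ, if_pos ha] at this
      omega
  let G : Fin n → Fin k ⊕ Fin (n - k) := fun v =>
    if hv : Kept π (v.val + 1) then
      .inr ⟨Nat.count (Kept π) (v.val + 1) - 1, by have := hcount v hv; omega⟩
    else .inl ⟨blockIdx π (v.val + 1), hblock v⟩
  have hGr : ∀ v (hv : Kept π (v.val + 1)), G v =
      .inr ⟨Nat.count (Kept π) (v.val + 1) - 1, by have := hcount v hv; omega⟩ :=
    fun v hv => dif_pos hv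
  have hGl : ∀ v (_ : ¬ Kept π (v.val + 1)), G v =
      .inl ⟨blockIdx π (v.val + 1), hblock v⟩ := fun v hv => dif_neg hv
  have hval : StrictMono (valKey (regionOrder π) ∘ G) := by
    intro v w hvw
    rw [Fin.lt_def] at hvw
    by_cases hv : Kept π (v.val + 1) <;> by_cases hw : Kept π (w.val + 1)
    · have h1 := hcount v hv
      have h2 := hcount w hw
      have := hclt _ _ hv (show v.val + 1 < w.val + 1 by omega)
      simp only [Function.comp, hGr v hv, hGr w hw, valKey, toLex_lt]
      omega
    · have h1 := hcount v hv
      simp only [Function.comp, hGr v hv, hGl w hw, valKey, toLex_lt]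
      left
      rw [Nat.sub_add_cancel h1.1]
      obtain ⟨h2, z, h3, h4, h5, h6⟩ := H.topEnd_spec (hblock w)
      -- Otherwise the right end of region `blockIdx w` is a kept vertex of a higher run lying
      -- between a vertex of that run and its start `w`, against 312-avoidance.
      by_contra hc
      have h7 := (nth_kept_strictMono π).monotone (not_lt.1 hc)
      rw [Nat.nth_count hv] at h7
      have h8 := nth_kept_strictMono π h4
      have h9 := (nth_kept_strictMono π).monotone h3
      have h10 := nth_kept_strictMono π (show 0 < 1 by omega)
      have h11 := time_le_of_not_kept h hw h5.symm
      have h12 := (isRegionOrder_time h).avoid _ _ (w.val + 1) (by omega) h8 (by omega)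
        (by omega) h11
      have h13 := blockIdx_mono h12
      simp only [regionOrder] at h5 h6
      omega
    · have h2 := hcount w hw
      simp only [Function.comp, hGl v hv, hGr w hw, valKey, toLex_lt]
      rw [Nat.sub_add_cancel h2.1]
      have hb := hblock v
      suffices topEnd (regionOrder π) (blockIdx π (v.val + 1)) ≤
          Nat.count (Kept π) (w.val + 1) by omega
      -- The parent `p` has the rank of `v`, and the first kept vertex after `v` has a higher one,
      -- so the pair bounds `topEnd`.
      obtain ⟨p, i1, i2, i3, i4, i5, i6⟩ := hd.exists_parent h hv
      have h3 := Nat.count_monotone (Kept π) (show v.val + 1 ≤ w.val + 1 by omega)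
      refine (topEnd_le (count_kept_pos i1) (hclt _ _ i4 i2) ((hq _ i4).trans i6) ?_).trans h3
      rw [regionOrder]
      have h4 := le_nth_count (π := π) (v.val + 1)
      have h5 : v.val + 1 ≠ Nat.nth (Kept π) (Nat.count (Kept π) (v.val + 1)) := fun he =>
        hv (he ▸ kept_nth _ _)
      have h6 : time π (v.val + 1 + 1) ≤
          time π (Nat.nth (Kept π) (Nat.count (Kept π) (v.val + 1))) :=
        time_le_kept (by omega) fun c j1 j2 => not_kept_between rfl (by omega) j2
      have hv' := hv
      rw [Kept, not_le] at hv'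
      refine lt_of_le_of_ne (blockIdx_mono (by omega)) fun he => ?_
      have h7 := hd.blockIdx_lt_iff.1 (he ▸ hb)
      have := run_decreasing' (lt_of_lt_of_le hv' h6) (time_lt h7.1 h7.2) he
      omega
    · simp only [Function.comp, hGl v hv, hGl w hw, valKey, toLex_lt]
      have ht : time π (v.val + 1) < time π (w.val + 1) := by
        rcases lt_trichotomy (time π (v.val + 1)) (time π (w.val + 1)) with i | i | i
        · exact i
        · have := time_inj i (time_lt (by omega) v.2)
          omega
        · have := lt_of_not_kept h hv (by omega) i
          omega
      have hb := blockIdx_mono ht.le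
      have hne : blockIdx π (v.val + 1) ≠ blockIdx π (w.val + 1) := fun he => by
        have := time_le_of_not_kept h hw he.symm
        omega
      have := H.topEnd_mono (hblock w) hb
      omega
  have hpos : StrictMono (posKey (regionOrder π) ∘ G ∘ π) := by
    intro i j hij
    have hti := time_entry π i
    have htj := time_entry π j
    rw [Fin.lt_def] at hij
    have hb := blockIdx_mono (π := π) (a := (π i).val + 1) (b := (π j).val + 1) (by omega)
    have hrun : blockIdx π ((π i).val + 1) = blockIdx π ((π j).val + 1) →
        (π j).val + 1 < (π i).val + 1 ∧ Kept π ((π j).val + 1) := fun he => by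
      refine ⟨run_decreasing' (by omega) (by omega) he, ?_⟩
      by_contra hc
      have := time_le_of_not_kept h hc he.symm
      omega
    by_cases hv : Kept π ((π i).val + 1) <;> by_cases hw : Kept π ((π j).val + 1)
    · have h1 := hcount _ hv
      have h2 := hcount _ hw
      simp only [Function.comp, hGr _ hv, hGr _ hw, posKey, toLex_lt]
      rw [Nat.sub_add_cancel h1.1, Nat.sub_add_cancel h2.1, hq _ hv, hq _ hw]
      rcases eq_or_lt_of_le hb with he | he
      · have := hclt _ _ hw (hrun he).1
        omega
      · omega
    · have h1 := hcount _ hv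
      simp only [Function.comp, hGr _ hv, hGl _ hw, posKey, toLex_lt]
      rw [Nat.sub_add_cancel h1.1, hq _ hv]
      rcases eq_or_lt_of_le hb with he | he
      · exact absurd (hrun he).2 hw
      · omega
    · have h2 := hcount _ hw
      simp only [Function.comp, hGl _ hv, hGr _ hw, posKey, toLex_lt]
      rw [Nat.sub_add_cancel h2.1, hq _ hw]
      omega
    · simp only [Function.comp, hGl _ hv, hGl _ hw, posKey, toLex_lt]
      rcases eq_or_lt_of_le hb with he | he
      · exact absurd (hrun he).2 hw
      · omega
  have hbij : Function.Bijective G := by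
    rw [Fintype.bijective_iff_injective_and_card]
    refine ⟨hval.injective.of_comp, ?_⟩
    simp
    omega
  exact ⟨Equiv.ofBijective G hbij, hval, hpos⟩

end DecentClip

/-! ### The bijection. -/

open DecentClip in
theorem theorem2 (n k : ℕ) (hk : 1 ≤ k) (hkn : k < n) :
    ∃ F : decentPerms312 n k ≃ dissections (n - k + 2) (k - 1),
      ∀ π : decentPerms312 n k,
        (∃! T : Finset (Sym2 (Fin (n + 2))),
          T ∈ triangulations (n + 2) ∧ IsClipSequence T π.1) ∧
        ∀ T : Finset (Sym2 (Fin (n + 2))),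
          T ∈ triangulations (n + 2) → IsClipSequence T π.1 →
            ClosesUpTo T π.1 (F π).1 := by
  have hn : 1 ≤ n := by omega
  have hM : 1 ≤ n - k := by omega
  have hlong : ∀ π : decentPerms312 n k, HasLongRuns π.1 k := fun π =>
    (isDecent_iff hk hn).1 π.2.2
  let f : decentPerms312 n k → dissections (n - k + 2) (k - 1) := fun π =>
    ⟨chordsOf (n - k) (regionOrder π.1), isDissection_chordsOf _ _, by
      have := ((hlong π).isRegionOrder π.2.1).card_chordsOf hM
      omega⟩
  have hf : Function.Bijective f := by
    constructor
    · intro π π' he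
      have h1 := (hlong π).represents π.2.1
      have h2 := (hlong π').represents π'.2.1
      rw [← ((hlong π).isRegionOrder π.2.1).eq_of_chordsOf_eq
        ((hlong π').isRegionOrder π'.2.1) hM (congrArg Subtype.val he)] at h2
      exact Subtype.ext (h1.unique h2)
    · rintro ⟨E, hE, hcard⟩
      obtain ⟨q, hq, rfl⟩ := exists_isRegionOrder hM hE
      rw [hcard, Nat.sub_add_cancel hk] at hq
      obtain ⟨π, g, h1, h2⟩ := exists_represents (n := n) (k := k) (M := n - k) (by omega) q
      refine ⟨⟨π, avoids312_of_keys hq h1 h2,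
        (isDecent_iff hk hn).2 (hasLongRuns_of_keys hq hn h1 h2)⟩, Subtype.ext ?_⟩
      exact congrArg (chordsOf (n - k)) (regionOrder_of_keys hq hn h1 h2)
  refine ⟨Equiv.ofBijective f hf, fun π => ⟨⟨chordsOf n (time π.1),
    ⟨chordsOf_mem_triangulations hn π.2.1, isClipSequence_chordsOf π.2.1⟩,
    fun T hT => eq_chordsOf_of_isClipSequence hn hT.1 hT.2⟩, fun T hT hc => ?_⟩⟩
  rw [eq_chordsOf_of_isClipSequence hn hT hc]
  exact (hlong π).closesUpTo π.2.1
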